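/- Throughout, a zero-dimensional system $(X,f)$ is a homeomorphism $f\colon X\to X$ of a compact metrizable space $X$ that has a basis of clopen sets. A Bratteli diagram consists of finite non-empty sets $V_0,V_1,\dots$ (vertices) and $E_1,E_2,\dots$ (edges) with $\#V_0=1$, together with surjective source maps $s\colon E_n\to V_{n-1}$ and surjective range maps $r\colon E_n\to V_n$ ($n\ge 1$). Its rank is $\liminf_{n\to\infty}\#V_n\in\{1,2,\dots,\infty\}$. It is ordered if every $E_n$ carries a partial order in which two edges are comparable if and only if they have the same range. Let $E_{0,\infty}$ be the space of infinite paths $(e_1,e_2,\dots)$, $e_n\in E_n$, $r(e_n)=s(e_{n+1})$, with the subspace topology of the product of the discrete sets $E_n$. A Vershik map is a homeomorphism $\phi$ of $E_{0,\infty}$ that maps the set of paths consisting of maximal edges bijectively onto the set of paths consisting of minimal edges and satisfies $\phi(e_1,e_2,\dots)=(f_1,\dots,f_{n-1},f_n,e_{n+1},e_{n+2},\dots)$ whenever $e_n$ is the first non-maximal edge, where $f_n$ is the least edge larger than $e_n$ and $f_1,\dots,f_{n-1}$ are minimal edges. The topological rank of $(X,f)$ is the least rank of an ordered Bratteli diagram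 with a Vershik map $\phi$ such that $(E_{0,\infty},\phi)$ is topologically conjugate to $(X,f)$ (and $\infty$ if there is none). A minimal set of $(X,f)$ is a non-empty closed set $M$ with $f(M)=M$ that contains no smaller such set. It is an odometer if $(M,f|_M)$ is topologically conjugate to the map $x\mapsto x+1$ on $\varprojlim \mathbb{Z}/q_n\mathbb{Z}$ for some unbounded sequence of positive integers $q_n$ with $q_n\mid q_{n+1}$ (so odometers are infinite). **Theorem 4.4 (Main Result).** Let $(X,f)$ be a zero-dimensional system of finite topological rank such that no minimal set of $(X,f)$ is an odometer. Then $(X,f)$ is expansive: for every metric $d$ inducing the topology of $X$ there is $\varepsilon>0$ such that for all $x\ne y$ in $X$ there is $n\in\mathbb{Z}$ with $d(f^n(x),f^n(y))>\varepsilon$. -/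

import Mathlib

open Set Filter Topology

/-- A Bratteli diagram: `V n` is the finite set of vertices of level `n`, and `E n` is the finite
set of edges from level `n` to level `n + 1`. Level `0` is a single vertex, every vertex emits an
edge, and every vertex of positive level receives an edge. (Non-emptiness of every `V n` and
every `E n` follows.) -/
structure BratteliDiagram where
  V : ℕ → Type
  E : ℕ → Type
  finite_V : ∀ n, Finite (V n)
  finite_E : ∀ n, Finite (E n)
  src : ∀ {n : ℕ}, E n → V n
  rng : ∀ {n : ℕ}, E n → V (n + 1)
  unique_zero : ∃ v₀ : V 0, ∀ v : V 0, v = v₀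
  src_surjective : ∀ n : ℕ, Function.Surjective (src : E n → V n)
  rng_surjective : ∀ n : ℕ, Function.Surjective (rng : E n → V (n + 1))

/-- The rank of a Bratteli diagram: `liminf` of the number of vertices of level `n`. -/
noncomputable def BratteliDiagram.rank (B : BratteliDiagram) : ℕ∞ :=
  liminf (fun n : ℕ => ENat.card (B.V n)) atTop

/-- An ordered Bratteli diagram: the edges carry a partial order in which two edges are comparable
if and only if they have the same range. -/
structure OrderedBratteliDiagram extends BratteliDiagram where
  order : ∀ n : ℕ, PartialOrder (E n)
  comparable_iff : ∀ (n : ℕ) (e e' : E n), (e ≤ e' ∨ e' ≤ e) ↔ rng e = rng e'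

namespace OrderedBratteliDiagram

instance (B : OrderedBratteliDiagram) (n : ℕ) : PartialOrder (B.E n) := B.order n

/-- The space of infinite paths starting at the vertex of level `0`. -/
def Path (B : OrderedBratteliDiagram) : Type :=
  {x : ∀ n : ℕ, B.E n // ∀ n : ℕ, B.rng (x n) = B.src (x (n + 1))}

/-- The edge from level `n` to level `n + 1` of an infinite path. -/
def Path.edge {B : OrderedBratteliDiagram} (x : B.Path) (n : ℕ) : B.E n := x.1 n

/-- The path space carries the subspace topology of the product of the discrete edge sets. -/
instance (B : OrderedBratteliDiagram) : TopologicalSpace B.Path :=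
  TopologicalSpace.induced (fun x : B.Path => fun n : ℕ => x.edge n)
    (@Pi.topologicalSpace ℕ B.E (fun _ => ⊥))

/-- The infinite paths all of whose edges are maximal. Since edges with different ranges are
incomparable, an edge is maximal in `E n` exactly if it is the maximum of the edges with its
range. -/
def maxPaths (B : OrderedBratteliDiagram) : Set B.Path := {x | ∀ n : ℕ, IsMax (x.edge n)}

/-- The infinite paths all of whose edges are minimal. -/
def minPaths (B : OrderedBratteliDiagram) : Set B.Path := {x | ∀ n : ℕ, IsMin (x.edge n)}

/-- A homeomorphism of the path space is a Vershik map if it maps the set of maximal paths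
bijectively onto the set of minimal paths, and sends a path whose first non-maximal edge is at
position `n` to its lexicographic successor: the `n`-th edge is replaced by the least larger one,
the edges before it by minimal edges, and the later edges stay unchanged. -/
def IsVershikMap (B : OrderedBratteliDiagram) (φ : B.Path ≃ₜ B.Path) : Prop :=
  BijOn φ B.maxPaths B.minPaths ∧
  ∀ (x : B.Path) (n : ℕ), (∀ k < n, IsMax (x.edge k)) → ¬ IsMax (x.edge n) →
    (∀ k < n, IsMin ((φ x).edge k)) ∧
    IsLeast {e : B.E n | x.edge n < e} ((φ x).edge n) ∧
    (∀ k > n, (φ x).edge k = x.edge k)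

end OrderedBratteliDiagram

/-- `B` together with the Vershik map `φ` is a Bratteli–Vershik representation of `(X, f)`: the two
systems are topologically conjugate. -/
def IsBratteliVershikRepresentation {X : Type*} [TopologicalSpace X] (f : X ≃ₜ X)
    (B : OrderedBratteliDiagram) (φ : B.Path ≃ₜ B.Path) : Prop :=
  B.IsVershikMap φ ∧ ∃ h : X ≃ₜ B.Path, ∀ x : X, h (f x) = φ (h x)

/-- The topological rank of `(X, f)`: the least rank of the ordered Bratteli diagrams underlying
its Bratteli–Vershik representations (`⊤` if there is no such representation). -/
noncomputable def topologicalRank {X : Type*} [TopologicalSpace X] (f : X ≃ₜ X) : ℕ∞ :=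
  sInf {K : ℕ∞ | ∃ (B : OrderedBratteliDiagram) (φ : B.Path ≃ₜ B.Path),
    IsBratteliVershikRepresentation f B φ ∧ B.rank = K}

/-- `M` is a minimal set of `(X, f)`: a minimal one among the non-empty closed sets `N` with
`f(N) = N`. -/
def IsMinimalSet {X : Type*} [TopologicalSpace X] (f : X ≃ₜ X) (M : Set X) : Prop :=
  Minimal (fun N : Set X => N.Nonempty ∧ IsClosed N ∧ f '' N = N) M

/-- The data of an (infinite) odometer: an unbounded sequence of positive integers, each of which
divides the next one. -/
structure OdometerScale where
  q : ℕ → ℕ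
  pos : ∀ n : ℕ, 0 < q n
  dvd : ∀ n : ℕ, q n ∣ q (n + 1)
  unbounded : ∀ N : ℕ, ∃ n : ℕ, N < q n

/-- The space of an odometer: the inverse limit of the discrete cyclic groups `ℤ / q n`, with the
subspace topology of the product. -/
abbrev OdometerScale.Space (S : OdometerScale) : Type :=
  {x : ∀ n : ℕ, ZMod (S.q n) //
    ∀ n : ℕ, ZMod.castHom (S.dvd n) (ZMod (S.q n)) (x (n + 1)) = x n}

/-- The odometer map: adding one in every coordinate. -/
def OdometerScale.addOne (S : OdometerScale) (x : S.Space) : S.Space :=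
  ⟨fun n => x.1 n + 1, fun n => by rw [map_add, map_one, x.2 n]⟩

/-- The subsystem of `(X, f)` on `M` is an odometer: it is topologically conjugate to the addition
of one on the inverse limit of some unbounded sequence of finite cyclic groups. -/
def IsOdometerOn {X : Type*} [TopologicalSpace X] (f : X ≃ₜ X) (M : Set X) : Prop :=
  ∃ (S : OdometerScale) (h : S.Space ≃ₜ M), ∀ x : S.Space, (h (S.addOne x) : X) = f (h x)

/-- Expansiveness of a homeomorphism of a metric space: some `ε > 0` is such that any two distinct
points are moved to a distance larger than `ε` by some (positive or negative) iterate. -/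
def IsExpansive {X : Type*} [MetricSpace X] (f : X ≃ₜ X) : Prop :=
  ∃ ε : ℝ, 0 < ε ∧ ∀ x y : X, x ≠ y → ∃ n : ℤ, ε < dist ((f ^ n) x) ((f ^ n) y)

/-! The first `n` edges of a path form a finite clopen code, and expansiveness means that for some
`n` the itinerary of this code determines the point. The towers over the vertices of level `n` cut
every level-`n` itinerary into words, at most one word per vertex. Words project to lower levels, so
finite rank gives one bound on the number of words for all levels. Let `r` be the least such bound.
At all sufficiently high levels `m`, fewer than `r` words never suffice, so for `n ≥ m` the words of
level `n`, projected to level `m`, form an elementary coding: it does not factor through a smaller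
alphabet (`IsCodeTower.exists_elementary`).

Elementary codings are rigid. By the graph lemma (`factorsThrough_card_quot`) every relation between
infinite concatenations costs a letter. Hence a one-sided concatenation determines its first letter,
and for a fixed non-empty word `u` all factorizations of streams `u ++ₛ y`, with `y` any
concatenation, start with the same letter. Two parses of one non-periodic sequence therefore have
common cuts arbitrarily far to the left (`exists_commonCut_le`): otherwise one of finitely many
local configurations recurs leftwards, and since it determines the sequence up to the next common
cut, it yields periodicity or a common cut left of the leftmost one. To the right of a common cut
the level-`m` itinerary determines the level-`n` itinerary, so a non-periodic level-`m` itinerary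
determines its point (`lift_eq`).

A periodic level-`m` itinerary has periodic lifts at all levels (`IsPeriodicSeq.lift`). If the point
itself is not periodic, the periods are unbounded and it generates an odometer
(`IsCodeTower.exists_odometer`), which is excluded. Periodic points are finite in number
(`IsCodeTower.finite_periodic`), so a high enough level separates them. -/

/-! ### Combinatorics on words: infinite factorizations and the graph lemma. -/

/-- The streams that are infinite concatenations of words `τ c`. -/
def Factorizable {C T : Type} (τ : C → List T) (y : Stream' T) : Prop :=
  ∃ S : Set (Stream' T), y ∈ S ∧ ∀ z ∈ S, ∃ c, ∃ z' ∈ S, z = τ c ++ₛ z'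

/-- The stream `y` is an infinite concatenation of words `τ c` that starts with `τ a`. -/
def FirstLetter {C T : Type} (τ : C → List T) (a : C) (y : Stream' T) : Prop :=
  ∃ z, Factorizable τ z ∧ y = τ a ++ₛ z

theorem FirstLetter.factorizable {C T : Type} {τ : C → List T} {a : C} {y : Stream' T}
    (h : FirstLetter τ a y) : Factorizable τ y := by
  obtain ⟨z, ⟨S, hz, hS⟩, rfl⟩ := h
  refine ⟨insert (τ a ++ₛ z) S, mem_insert _ _, ?_⟩
  rintro w (rfl | hw)
  · exact ⟨a, z, mem_insert_of_mem _ hz, rfl⟩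
  · obtain ⟨c, z', hz', e⟩ := hS w hw
    exact ⟨c, z', mem_insert_of_mem _ hz', e⟩

theorem Factorizable.exists_firstLetter {C T : Type} {τ : C → List T} {y : Stream' T}
    (h : Factorizable τ y) : ∃ a, FirstLetter τ a y := by
  obtain ⟨S, hy, hS⟩ := h
  obtain ⟨c, z, hz, e⟩ := hS y hy
  exact ⟨c, z, ⟨S, hz, hS⟩, e⟩

/-- Two letters are related if some stream has factorizations starting with either of them. -/
def FirstLetterRel {C T : Type} (τ : C → List T) (a b : C) : Prop :=
  ∃ y, FirstLetter τ a y ∧ FirstLetter τ b y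

theorem FirstLetterRel.symm {C T : Type} {τ : C → List T} {a b : C}
    (h : FirstLetterRel τ a b) : FirstLetterRel τ b a :=
  let ⟨y, h₁, h₂⟩ := h; ⟨y, h₂, h₁⟩

/-- The coding `τ` factors through an alphabet with at most `k` letters. -/
def FactorsThrough {C T : Type} (τ : C → List T) (k : ℕ) : Prop :=
  ∃ (D : Type) (_ : Finite D) (α : C → List D) (β : D → List T), Nat.card D ≤ k ∧
    (∀ d, β d ≠ []) ∧ ∀ c, τ c = (α c).flatMap β

theorem FactorsThrough.mono {C T : Type} {τ : C → List T} {k l : ℕ} (h : FactorsThrough τ k)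
    (hkl : k ≤ l) : FactorsThrough τ l :=
  let ⟨D, hD, α, β, h₁, h₂, h₃⟩ := h; ⟨D, hD, α, β, h₁.trans hkl, h₂, h₃⟩

theorem FactorsThrough.comp {C C' T : Type} {τ : C → List T} {τ' : C' → List T}
    {ρ : C → List C'} (hρ : ∀ c, τ c = (ρ c).flatMap τ') {k : ℕ} (h : FactorsThrough τ' k) :
    FactorsThrough τ k := by
  obtain ⟨D, hD, α, β, h₁, h₂, h₃⟩ := h
  refine ⟨D, hD, fun c => (ρ c).flatMap α, β, h₁, h₂, fun c => ?_⟩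
  rw [hρ, List.flatMap_assoc]
  congr 1
  funext d
  exact h₃ d

theorem prefix_of_append_stream_eq {T : Type} {u v : List T} {y z : Stream' T}
    (h : u ++ₛ y = v ++ₛ z) (hl : u.length ≤ v.length) : ∃ s, v = u ++ s ∧ y = s ++ₛ z := by
  have hv : v = v.take u.length ++ v.drop u.length := (List.take_append_drop _ _).symm
  rw [hv, Stream'.append_append_stream] at h
  have hu := Stream'.append_left_injective _ _ _ _ h (by simp [hl])
  refine ⟨v.drop u.length, by rw [← hu] at hv; exact hv, ?_⟩
  rw [← hu] at h
  exact Stream'.append_right_injective _ _ _ h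

/-- The graph lemma of combinatorics on words: a coding factors through an alphabet that has at
most as many letters as the graph of the first letters of its infinite relations has connected
components. -/
theorem factorsThrough_card_quot {T : Type} (N : ℕ) : ∀ (C : Type) [Fintype C] (τ : C → List T),
    (∀ c, τ c ≠ []) → (∑ c, (τ c).length) ≤ N →
    FactorsThrough τ (Nat.card (Quot (FirstLetterRel τ))) := by
  classical
  induction N with
  | zero =>
    intro C _ τ hτ hN
    have hC : IsEmpty C := ⟨fun c => hτ c (by
      have := (Finset.sum_eq_zero_iff.1 (Nat.le_zero.1 hN)) c (Finset.mem_univ _)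
      exact List.length_eq_zero_iff.1 this)⟩
    refine ⟨C, inferInstance, fun c => [c], τ, by simp, hτ, fun c => by simp⟩
  | succ N ih =>
    intro C _ τ hτ hN
    by_cases hinj : Function.Injective (Quot.mk (FirstLetterRel τ))
    · exact ⟨C, inferInstance, fun c => [c], τ, Nat.card_le_card_of_injective _ hinj, hτ,
        fun c => by simp⟩
    -- Two distinct letters must be related, since otherwise the quotient map would be injective; by
    -- symmetry the first has the shorter word, which is then a prefix of the other.
    have hab : ∃ a b, a ≠ b ∧ FirstLetterRel τ a b ∧ (τ a).length ≤ (τ b).length := by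
      by_contra! hcon
      have hr : ∀ a b, FirstLetterRel τ a b → a = b := by
        intro a b h
        by_contra hne
        have h1 := hcon a b hne h
        have h2 := hcon b a (Ne.symm hne) h.symm
        omega
      refine hinj fun a b h => ?_
      have := congrArg (Quot.lift id hr) h
      exact this
    obtain ⟨a, b, hne, ⟨y, ⟨y₁, hy₁, e₁⟩, ⟨y₂, hy₂, e₂⟩⟩, hlen⟩ := hab
    obtain ⟨s, hs, hys⟩ := prefix_of_append_stream_eq (e₁.symm.trans e₂) hlen
    by_cases hs0 : s = []
    · -- the two letters have the same image: drop one of them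
      have hτab : τ b = τ a := by simp [hs, hs0]
      let C' := {c : C // c ≠ b}
      let g : C → C' := fun c => if h : c = b then ⟨a, hne⟩ else ⟨c, h⟩
      let τ' : C' → List T := fun c => τ c
      have hg : ∀ c, τ' (g c) = τ c := by
        intro c
        by_cases h : c = b
        · simp [g, τ', h, hτab]
        · simp [g, τ', h]
      have hfact : ∀ z, Factorizable τ z → Factorizable τ' z := by
        rintro z ⟨S, hz, hS⟩
        refine ⟨S, hz, fun w hw => ?_⟩
        obtain ⟨c, z', hz', e⟩ := hS w hw
        exact ⟨g c, z', hz', by rw [hg, e]⟩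
      have hfirst : ∀ c z, FirstLetter τ c z → FirstLetter τ' (g c) z := by
        rintro c z ⟨w, hw, e⟩
        exact ⟨w, hfact w hw, by rw [hg, e]⟩
      have hsum : ∑ c : C', (τ' c).length ≤ N := by
        have h1 : ∑ c : C', (τ' c).length + (τ b).length = ∑ c, (τ c).length := by
          rw [← Finset.sum_erase_add _ _ (Finset.mem_univ b)]
          congr 1
          exact (Finset.sum_subtype (Finset.univ.erase b) (by simp)
            (fun c => (τ c).length)).symm
        have := List.length_pos_iff.2 (hτ b)
        omega
      have hq : Nat.card (Quot (FirstLetterRel τ')) ≤ Nat.card (Quot (FirstLetterRel τ)) := by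
        refine Nat.card_le_card_of_surjective
          (Quot.lift (fun c => Quot.mk (FirstLetterRel τ') (g c)) ?_) ?_
        · rintro c d ⟨z, h1, h2⟩
          exact Quot.sound ⟨z, hfirst _ _ h1, hfirst _ _ h2⟩
        · rintro ⟨c⟩
          refine ⟨Quot.mk _ c.1, ?_⟩
          have : g c.1 = c := by simp [g, c.2]
          simp [this]
      exact FactorsThrough.comp (ρ := fun c => [g c]) (fun c => by simp [hg])
        ((ih C' τ' (fun c => hτ c) hsum).mono hq)
    · -- split the longer image
      let g : C → C := fun c => if c = b then a else c
      let τ' : C → List T := Function.update τ b s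
      have hτ'b : τ' b = s := by simp [τ']
      have hτ'c : ∀ c, c ≠ b → τ' c = τ c := fun c h => by simp [τ', h]
      -- Reading `τ b` as `τ a` followed by `s` leaves a pending `s` after the first half. Allowing
      -- streams with a pending `s` makes the set closed under removing a `τ'`-word.
      have hfact' : ∀ z, (∃ w, Factorizable τ w ∧ (z = w ∨ z = s ++ₛ w)) →
          Factorizable τ' z := by
        intro z hz
        refine ⟨{z | ∃ w, Factorizable τ w ∧ (z = w ∨ z = s ++ₛ w)}, hz, ?_⟩
        rintro z ⟨w, hw, rfl | rfl⟩
        · obtain ⟨c, w', hw', e⟩ := hw.exists_firstLetter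
          by_cases hc : c = b
          · subst hc
            exact ⟨a, s ++ₛ w', ⟨w', hw', Or.inr rfl⟩, by
              rw [hτ'c a hne, e, hs, Stream'.append_append_stream]⟩
          · exact ⟨c, w', ⟨w', hw', Or.inl rfl⟩, by rw [hτ'c c hc, e]⟩
        · exact ⟨b, w, ⟨w, hw, Or.inl rfl⟩, by rw [hτ'b]⟩
      have hfact : ∀ z, Factorizable τ z → Factorizable τ' z :=
        fun z hz => hfact' z ⟨z, hz, Or.inl rfl⟩
      have hfirst : ∀ c z, FirstLetter τ c z → FirstLetter τ' (g c) z := by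
        rintro c z ⟨w, hw, e⟩
        by_cases hc : c = b
        · subst hc
          refine ⟨s ++ₛ w, hfact' _ ⟨w, hw, Or.inr rfl⟩, ?_⟩
          simp only [g, if_true]
          rw [hτ'c a hne, e, hs, Stream'.append_append_stream]
        · refine ⟨w, hfact w hw, ?_⟩
          simp only [g, hc, if_false]
          rw [hτ'c c hc, e]
      have hgb : ∀ c, g c ≠ b := by
        intro c
        by_cases hc : c = b
        · simp [g, hc, hne]
        · simp [g, hc]
      have hgg : ∀ c, c ≠ b → g c = c := fun c hc => by simp [g, hc]
      have hne' : ∀ c, τ' c ≠ [] := by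
        intro c
        by_cases hc : c = b
        · rw [hc, hτ'b]; exact hs0
        · rw [hτ'c c hc]; exact hτ c
      have hsum : ∑ c, (τ' c).length ≤ N := by
        have h1 : ∑ c, (τ c).length = ∑ c ∈ Finset.univ.erase b, (τ c).length + (τ b).length :=
          (Finset.sum_erase_add _ _ (Finset.mem_univ b)).symm
        have h2 : ∑ c, (τ' c).length =
            ∑ c ∈ Finset.univ.erase b, (τ' c).length + (τ' b).length :=
          (Finset.sum_erase_add _ _ (Finset.mem_univ b)).symm
        have h3 : ∑ c ∈ Finset.univ.erase b, (τ' c).length =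
            ∑ c ∈ Finset.univ.erase b, (τ c).length :=
          Finset.sum_congr rfl fun c hc => by rw [hτ'c c (Finset.ne_of_mem_erase hc)]
        have h4 : (τ b).length = (τ a).length + s.length := by rw [hs, List.length_append]
        have := List.length_pos_iff.2 (hτ a)
        rw [hτ'b] at h2
        omega
      have hq : Nat.card (Quot (FirstLetterRel τ')) ≤ Nat.card (Quot (FirstLetterRel τ)) := by
        refine Nat.card_le_card_of_surjective
          (Quot.lift (fun c => Quot.mk (FirstLetterRel τ') (g c)) ?_) ?_
        · rintro c d ⟨z, h1, h2⟩
          exact Quot.sound ⟨z, hfirst _ _ h1, hfirst _ _ h2⟩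
        · rintro ⟨c⟩
          by_cases hc : c = b
          -- No `g c` equals `b`, but `b` adds no class: it now codes `s`, and `y₁ = s ++ₛ y₂`
          -- relates it to the first letter of `y₁`.
          · obtain ⟨c₀, hc₀⟩ := hy₁.exists_firstLetter
            refine ⟨Quot.mk _ c₀, ?_⟩
            refine Quot.sound ⟨y₁, hfirst _ _ hc₀, ?_⟩
            rw [hc]
            exact ⟨y₂, hfact _ hy₂, by rw [hτ'b, hys]⟩
          · refine ⟨Quot.mk _ c, ?_⟩
            simp [hgg c hc]
      refine FactorsThrough.comp (ρ := fun c => if c = b then [a, b] else [c]) (fun c => ?_)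
        ((ih C τ' hne' hsum).mono hq)
      by_cases hc : c = b
      · simp [hc, hτ'b, hτ'c a hne, hs]
      · simp [hc, hτ'c c hc]

/-! ### Elementary codings and their rigidity on one-sided words. -/

/-- A coding is elementary if it does not factor through a smaller alphabet. -/
def Elementary {C T : Type} (τ : C → List T) : Prop :=
  ∀ k, FactorsThrough τ k → Nat.card C ≤ k

theorem card_quot_lt {C : Type} [Finite C] {r : C → C → Prop} {a b : C} (hne : a ≠ b)
    (h : r a b) : Nat.card (Quot r) < Nat.card C := by
  classical
  have : Fintype C := Fintype.ofFinite C
  have h1 : Nat.card (Quot r) ≤ Nat.card {c : C // c ≠ b} := by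
    refine Nat.card_le_card_of_surjective (fun c => Quot.mk r c.1) ?_
    rintro ⟨c⟩
    by_cases hc : c = b
    · exact ⟨⟨a, hne⟩, by rw [hc]; exact Quot.sound h⟩
    · exact ⟨⟨c, hc⟩, rfl⟩
  have h2 : Nat.card {c : C // c ≠ b} < Nat.card C := by
    simp only [Nat.card_eq_fintype_card]
    exact Fintype.card_subtype_lt (x := b) (by simp)
  omega

/-- Elementary codings are injective on one-sided infinite words. -/
theorem Elementary.firstLetter_eq {C T : Type} [Finite C] {τ : C → List T} (hτ : Elementary τ)
    (hne : ∀ c, τ c ≠ []) {a b : C} (h : FirstLetterRel τ a b) : a = b := by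
  classical
  have : Fintype C := Fintype.ofFinite C
  by_contra hab
  have h1 := hτ _ (factorsThrough_card_quot _ C τ hne le_rfl)
  have h2 := card_quot_lt hab h
  omega

/-- For an elementary coding and a non-empty word `u`, all factorizations of streams that differ
from a factorizable stream by the prefix `u` start with the same letter. -/
theorem Elementary.firstLetter_eq_of_append {C T : Type} [Finite C] {τ : C → List T}
    (hτ : Elementary τ) (hne : ∀ c, τ c ≠ []) {a b : C} {u : List T} (hu : u ≠ [])
    {y z : Stream' T} (hy : Factorizable τ y) (hz : Factorizable τ z)
    (ha : FirstLetter τ a (u ++ₛ y)) (hb : FirstLetter τ b (u ++ₛ z)) : a = b := by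
  classical
  have : Fintype C := Fintype.ofFinite C
  by_contra hab
  -- Adjoin `u` as an extra letter. It is related to both `a` and `b`, and these two identifications
  -- bring the number of classes below `Nat.card C`.
  let τ' : Option C → List T := fun o => o.elim u τ
  have hne' : ∀ o, τ' o ≠ [] := by rintro (_ | c); exacts [hu, hne c]
  have hfact : ∀ w, Factorizable τ w → Factorizable τ' w := by
    rintro w ⟨S, hw, hS⟩
    refine ⟨S, hw, fun v hv => ?_⟩
    obtain ⟨c, h⟩ := hS v hv
    exact ⟨some c, h⟩
  have hfirst : ∀ c w, FirstLetter τ c w → FirstLetter τ' (some c) w :=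
    fun c w ⟨v, hv, e⟩ => ⟨v, hfact v hv, e⟩
  have hra : FirstLetterRel τ' none (some a) := ⟨_, ⟨y, hfact y hy, rfl⟩, hfirst _ _ ha⟩
  have hrb : FirstLetterRel τ' none (some b) := ⟨_, ⟨z, hfact z hz, rfl⟩, hfirst _ _ hb⟩
  have h1 : Nat.card (Quot (FirstLetterRel τ')) ≤ Nat.card {c : C // c ≠ b} := by
    refine Nat.card_le_card_of_surjective
      (fun c => Quot.mk (FirstLetterRel τ') (some c.1)) ?_
    rintro ⟨_ | c⟩
    · exact ⟨⟨a, hab⟩, (Quot.sound hra).symm⟩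
    · by_cases hc : c = b
      · refine ⟨⟨a, hab⟩, ?_⟩
        rw [hc]
        exact (Quot.sound hra).symm.trans (Quot.sound hrb)
      · exact ⟨⟨c, hc⟩, rfl⟩
  have h2 : Nat.card {c : C // c ≠ b} < Nat.card C := by
    simp only [Nat.card_eq_fintype_card]
    exact Fintype.card_subtype_lt (x := b) (by simp)
  have h3 := hτ _ (FactorsThrough.comp (ρ := fun c => [some c]) (fun c => by simp [τ'])
    (factorsThrough_card_quot _ (Option C) τ' hne' le_rfl))
  omega

/-! ### Two-sided sequences cut into words. -/

/-- The one-sided sequence that a two-sided sequence shows from position `d` on. -/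
def tailAt {T : Type} (y : ℤ → T) (d : ℤ) : Stream' T := fun t : ℕ => y (d + t)

theorem tailAt_eq_iff {T : Type} {y z : ℤ → T} {d e : ℤ} :
    tailAt y d = tailAt z e ↔ ∀ t : ℕ, y (d + t) = z (e + t) :=
  ⟨fun h t => congrFun h t, fun h => funext h⟩

theorem tailAt_add {T : Type} {y z : ℤ → T} {d e : ℤ} (h : tailAt y d = tailAt z e) (n : ℕ) :
    tailAt y (d + n) = tailAt z (e + n) := by
  rw [tailAt_eq_iff] at h ⊢
  intro t
  have := h (n + t)
  push_cast at this
  rwa [← add_assoc, ← add_assoc] at this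

theorem tailAt_of_eq_append {T : Type} {y : ℤ → T} {d : ℤ} {u : List T} {s : Stream' T}
    (h : tailAt y d = u ++ₛ s) : tailAt y (d + u.length) = s := by
  rw [← Stream'.drop_append_stream u s, ← h]
  funext t
  change y (d + u.length + t) = y (d + ((t + u.length : ℕ) : ℤ))
  push_cast
  ring_nf

theorem eq_or_of_append_cons_eq {D : Type} {l m l' m' : List D} {x x' : D}
    (h : l ++ x :: m = l' ++ x' :: m') :
    (l = l' ∧ x = x') ∨ (∃ k, l' = l ++ x :: k) ∨ ∃ k, l = l' ++ x' :: k := by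
  rcases List.append_eq_append_iff.1 h with ⟨k, rfl, hk⟩ | ⟨k, rfl, hk⟩
  · rcases k with _ | ⟨z, k⟩
    · exact Or.inl (by simp_all)
    · exact Or.inr (Or.inl ⟨k, by simp_all⟩)
  · rcases k with _ | ⟨z, k⟩
    · exact Or.inl (by simp_all)
    · exact Or.inr (Or.inr ⟨k, by simp_all⟩)

/-- `P d a` says that the two-sided sequence `y`, cut into words `β c`, has a cut at `d` that is
followed by the word `β a`. -/
structure IsParse {C T : Type} (β : C → List T) (y : ℤ → T) (P : ℤ → C → Prop) : Prop where
  exists_le : ∀ i : ℤ, ∃ d a, P d a ∧ d ≤ i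
  next : ∀ d a, P d a → ∃ b, P (d + (β a).length) b
  gap : ∀ d a e b, P d a → P e b → d < e → d + (β a).length ≤ e
  unique : ∀ d a b, P d a → P d b → a = b
  tailAt_eq : ∀ d a, P d a → tailAt y d = β a ++ₛ tailAt y (d + (β a).length)

section Parse
variable {C T : Type} {β : C → List T} {y z : ℤ → T} {P Q : ℤ → C → Prop}

/-- The tails of `y` at the cuts form a set closed under removing a word, which is the witness that
`Factorizable` asks for. -/
theorem IsParse.firstLetter (hP : IsParse β y P) {d : ℤ} {a : C} (h : P d a) :
    FirstLetter β a (tailAt y d) := by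
  refine ⟨_, ⟨{w | ∃ e b, P e b ∧ w = tailAt y e}, ?_, ?_⟩, hP.tailAt_eq d a h⟩
  · obtain ⟨b, hb⟩ := hP.next d a h
    exact ⟨_, b, hb, rfl⟩
  · rintro w ⟨e, b, hb, rfl⟩
    obtain ⟨b', hb'⟩ := hP.next e b hb
    exact ⟨b, _, ⟨_, b', hb', rfl⟩, hP.tailAt_eq e b hb⟩

theorem IsParse.apply_eq (hP : IsParse β y P) {d : ℤ} {a : C} (h : P d a) {k : ℕ}
    (hk : k < (β a).length) : y (d + k) = (β a)[k] := by
  have h1 : (tailAt y d).get k = (β a ++ₛ tailAt y (d + (β a).length)).get k := by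
    rw [← hP.tailAt_eq d a h]
  rw [Stream'.get_append_left _ _ _ hk] at h1
  exact h1

theorem IsParse.exists_cover (hP : IsParse β y P) (hne : ∀ c, β c ≠ []) (i : ℤ) :
    ∃ d a, P d a ∧ d ≤ i ∧ i < d + (β a).length := by
  obtain ⟨d₀, a₀, h₀, hd₀⟩ := hP.exists_le i
  obtain ⟨d, ⟨⟨a, ha⟩, hdi⟩, hmax⟩ := Int.exists_greatest_of_bdd
    (P := fun d => (∃ a, P d a) ∧ d ≤ i) ⟨i, fun _ h => h.2⟩ ⟨d₀, ⟨a₀, h₀⟩, hd₀⟩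
  refine ⟨d, a, ha, hdi, ?_⟩
  by_contra! hcon
  have h1 := hmax _ ⟨hP.next d a ha, hcon⟩
  have := List.length_pos_iff.2 (hne a)
  omega

theorem IsParse.map {T' : Type} (hP : IsParse β y P) (p : T → T') :
    IsParse (fun c => (β c).map p) (fun i => p (y i)) P where
  exists_le := hP.exists_le
  next := fun d a h => by simpa using hP.next d a h
  gap := fun d a e b h h' hde => by simpa using hP.gap d a e b h h' hde
  unique := hP.unique
  tailAt_eq := fun d a h => by
    have := congrArg (Stream'.map p) (hP.tailAt_eq d a h)
    rw [Stream'.map_append_stream] at this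
    rw [List.length_map]
    exact this

/-- If a coding factors through another one, then parses for the first yield parses for the
second. -/
theorem IsParse.refine {D : Type} {α : C → List D} {β' : D → List T} (hP : IsParse β y P)
    (hne : ∀ c, β c ≠ []) (hne' : ∀ c, β' c ≠ []) (hβ : ∀ c, β c = (α c).flatMap β') :
    ∃ Q, IsParse β' y Q := by
  have hα : ∀ c, ∃ x l, α c = x :: l := by
    intro c
    rcases h : α c with _ | ⟨x, l⟩
    · exact absurd (by rw [hβ, h]; rfl) (hne c)
    · exact ⟨x, l, rfl⟩
  -- The old cuts are kept, and each word `β a` is cut further along the letters of `α a`.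
  let Q : ℤ → D → Prop := fun i x => ∃ d a l l', P d a ∧ α a = l ++ x :: l' ∧
    i = d + (l.flatMap β').length
  have hlen : ∀ {a : C} {l l' : List D} {x : D}, α a = l ++ x :: l' →
      (β a).length = (l.flatMap β').length + (β' x).length + (l'.flatMap β').length := by
    intro a l l' x h
    rw [hβ, h]
    simp [add_assoc]
  refine ⟨Q, ?_, ?_, ?_, ?_, ?_⟩
  · intro i
    obtain ⟨d, a, h, hd⟩ := hP.exists_le i
    obtain ⟨x, l, hx⟩ := hα a
    exact ⟨d, x, ⟨d, a, [], l, h, hx, by simp⟩, hd⟩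
  · rintro _ x ⟨d, a, l, l', h, hx, rfl⟩
    rcases l' with _ | ⟨x', l'⟩
    · obtain ⟨b, hb⟩ := hP.next d a h
      obtain ⟨x'', l'', hx''⟩ := hα b
      refine ⟨x'', _, b, [], l'', hb, hx'', ?_⟩
      rw [hlen hx]
      simp [add_assoc]
    · refine ⟨x', d, a, l ++ [x], l', h, by simp [hx], ?_⟩
      simp [add_assoc]
  · rintro _ x _ x' ⟨d, a, l, m, h, hx, rfl⟩ ⟨e, b, l', m', h', hx', rfl⟩ hlt
    have h1 := hlen hx
    have h2 := hlen hx'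
    have h3 := List.length_pos_iff.2 (hne' x')
    rcases lt_trichotomy d e with hde | rfl | hde
    · have := hP.gap d a e b h h' hde
      omega
    · obtain rfl := hP.unique _ _ _ h h'
      rcases eq_or_of_append_cons_eq (hx.symm.trans hx') with ⟨rfl, -⟩ | ⟨k, rfl⟩ | ⟨k, rfl⟩
      · omega
      · simp only [List.flatMap_append, List.flatMap_cons, List.length_append] at hlt ⊢
        push_cast
        omega
      · simp only [List.flatMap_append, List.flatMap_cons, List.length_append] at hlt
        push_cast at hlt
        omega
    · have := hP.gap e b d a h' h hde
      omega
  · rintro _ x x' ⟨d, a, l, m, h, hx, rfl⟩ ⟨e, b, l', m', h', hx', he⟩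
    have h1 := hlen hx
    have h2 := hlen hx'
    have h3 := List.length_pos_iff.2 (hne' x')
    have h4 := List.length_pos_iff.2 (hne' x)
    rcases lt_trichotomy d e with hde | rfl | hde
    · have := hP.gap d a e b h h' hde
      omega
    · obtain rfl := hP.unique _ _ _ h h'
      rcases eq_or_of_append_cons_eq (hx.symm.trans hx') with ⟨-, h⟩ | ⟨k, rfl⟩ | ⟨k, rfl⟩
      · exact h
      · simp only [List.flatMap_append, List.flatMap_cons, List.length_append] at he
        push_cast at he
        omega
      · simp only [List.flatMap_append, List.flatMap_cons, List.length_append] at he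
        push_cast at he
        omega
    · have := hP.gap e b d a h' h hde
      omega
  · rintro _ x ⟨d, a, l, l', h, hx, rfl⟩
    have h1 := hP.tailAt_eq d a h
    have h2 : β a = l.flatMap β' ++ (β' x ++ l'.flatMap β') := by rw [hβ, hx]; simp
    rw [h2, Stream'.append_append_stream, Stream'.append_append_stream] at h1
    have h3 := tailAt_of_eq_append h1
    rw [tailAt_of_eq_append h3, h3]

end Parse

/-! ### Recognizability: common cuts of two parses. -/

/-- A two-sided sequence is periodic. -/
def IsPeriodicSeq {T : Type} (y : ℤ → T) : Prop :=
  ∃ p : ℕ, 0 < p ∧ ∀ s, y (s + p) = y s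

/-- The difference of two positions in `S` is a period: at any `s`, choose a position of `S` left of
`s` and compare its tail with the tails at the two positions. -/
theorem isPeriodicSeq_of_tails {T : Type} {y : ℤ → T} (S : ℤ → Prop)
    (hS : ∀ i, ∃ d ≤ i, S d) (h : ∀ d e, S d → S e → ∀ t : ℕ, y (d + t) = y (e + t)) :
    IsPeriodicSeq y := by
  obtain ⟨d₀, -, h₀⟩ := hS 0
  obtain ⟨d₁, h₁, h₁'⟩ := hS (d₀ - 1)
  refine ⟨(d₀ - d₁).toNat, by omega, fun s => ?_⟩
  obtain ⟨d, hd, hd'⟩ := hS s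
  have e1 := h d d₁ hd' h₁' ((s - d).toNat + (d₀ - d₁).toNat)
  have e2 := h d d₀ hd' h₀ (s - d).toNat
  have a1 : d + (((s - d).toNat + (d₀ - d₁).toNat : ℕ) : ℤ) = s + (d₀ - d₁).toNat := by omega
  have a2 : d₁ + (((s - d).toNat + (d₀ - d₁).toNat : ℕ) : ℤ) = d₀ + (s - d).toNat := by omega
  have a3 : d + ((s - d).toNat : ℤ) = s := by omega
  rw [a1, a2] at e1
  rw [a3] at e2
  rw [e1, e2]

/-- Pigeonhole: finitely many states, each bounded to the left, have a common lower bound. -/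
theorem exists_state_unbounded {σ : Type*} [Finite σ] {R : ℤ → σ → Prop}
    (h : ∀ i : ℤ, ∃ d ≤ i, ∃ s, R d s) : ∃ s, ∀ i : ℤ, ∃ d ≤ i, R d s := by
  by_contra! hcon
  choose b hb using hcon
  obtain ⟨m, hm⟩ := (Set.finite_range b).bddBelow
  obtain ⟨d, hd, s, hs⟩ := h m
  exact hb s d (hd.trans (hm ⟨s, rfl⟩)) hs

section Recognizability
variable {C T : Type} {β : C → List T} {y : ℤ → T} {P Q P' Q' : ℤ → C → Prop}

/-- `P` and `Q` have a common cut at `d`. -/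
def CommonCut (P Q : ℤ → C → Prop) (d : ℤ) : Prop := (∃ a, P d a) ∧ ∃ b, Q d b

theorem CommonCut.symm {d : ℤ} (h : CommonCut P Q d) : CommonCut Q P d := ⟨h.2, h.1⟩

/-- `P` has a cut at `d`, and the first cut of `Q` from `d` on is at `d + L`, where `L > 0`. -/
def Overhang (P Q : ℤ → C → Prop) (d : ℤ) (L : ℕ) : Prop :=
  (∃ a, P d a) ∧ (∃ b, Q (d + L) b) ∧ 0 < L ∧ ∀ e c, Q e c → d ≤ e → d + L ≤ e

theorem Overhang.not_commonCut {d : ℤ} {L : ℕ} (h : Overhang P Q d L) {e : ℤ} (hd : d ≤ e)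
    (he : e < d + L) : ¬ CommonCut P Q e := by
  rintro ⟨-, b, hb⟩
  have := h.2.2.2 e b hb hd
  omega

theorem Overhang.step_lt (hP : IsParse β y P) {d : ℤ} {L : ℕ} (h : Overhang P Q d L)
    {a : C} (ha : P d a) (hl : (β a).length < L) :
    Overhang P Q (d + (β a).length) (L - (β a).length) := by
  obtain ⟨-, ⟨b, hb⟩, -, hgap⟩ := h
  have e : d + ((β a).length : ℤ) + ((L - (β a).length : ℕ) : ℤ) = d + L := by omega
  refine ⟨hP.next d a ha, ⟨b, by rwa [e]⟩, by omega, fun i c hc hi => ?_⟩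
  have := hgap i c hc (by omega)
  omega

/-- The word of `P` passes the next cut of `Q`, so the two parses exchange their roles. -/
theorem Overhang.step_gt (hP : IsParse β y P) {d : ℤ} {L : ℕ} (h : Overhang P Q d L)
    {a : C} (ha : P d a) (hl : L < (β a).length) :
    Overhang Q P (d + L) ((β a).length - L) := by
  obtain ⟨-, hb, hL, -⟩ := h
  obtain ⟨b, hb'⟩ := hP.next d a ha
  have e : d + (L : ℤ) + (((β a).length - L : ℕ) : ℤ) = d + (β a).length := by omega
  refine ⟨hb, ⟨b, by rwa [e]⟩, by omega, fun i c hc hi => ?_⟩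
  have := hP.gap d a i c ha hc (by omega)
  omega

/-- The `L` symbols before the next cut of the other parse are the same non-empty word `u` at `d`
and at `e`, and each is followed by a factorizable tail. The tails may differ;
`Elementary.firstLetter_eq_of_append` needs only the common prefix. -/
theorem Overhang.letter_eq [Finite C] (hβ : Elementary β) (hne : ∀ c, β c ≠ [])
    (hP : IsParse β y P) (hQ : IsParse β y Q) (hP' : IsParse β y P') (hQ' : IsParse β y Q')
    {d e : ℤ} {L : ℕ} (h : Overhang P Q d L) (h' : Overhang P' Q' e L)
    (hy : ∀ j < L, y (d + j) = y (e + j)) {a b : C} (ha : P d a) (hb : P' e b) : a = b := by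
  obtain ⟨-, ⟨c, hc⟩, hL, -⟩ := h
  obtain ⟨-, ⟨c', hc'⟩, -, -⟩ := h'
  have split : ∀ i : ℤ, tailAt y i = (tailAt y i).take L ++ₛ tailAt y (i + L) := by
    intro i
    conv_lhs => rw [← Stream'.append_take_drop L (tailAt y i)]
    congr 1
    funext t
    change y (i + ((t + L : ℕ) : ℤ)) = y (i + L + t)
    push_cast
    ring_nf
  have htake : (tailAt y d).take L = (tailAt y e).take L := by
    refine List.ext_getElem (by simp) fun n h1 _ => ?_
    simp only [Stream'.length_take] at h1
    simp only [Stream'.take_get]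
    exact hy n h1
  have ha' := hP.firstLetter ha
  have hb' := hP'.firstLetter hb
  rw [split d] at ha'
  rw [split e, ← htake] at hb'
  refine hβ.firstLetter_eq_of_append hne ?_ (hQ.firstLetter hc).factorizable
    (hQ'.firstLetter hc').factorizable ha' hb'
  rw [← List.length_pos_iff]
  simpa using hL

/-- An overhang determines the sequence up to the next overhang or the next common cut. -/
theorem Overhang.step [Finite C] (hβ : Elementary β) (hne : ∀ c, β c ≠ [])
    (hP : IsParse β y P) (hQ : IsParse β y Q) (hP' : IsParse β y P') (hQ' : IsParse β y Q')
    {d e : ℤ} {L : ℕ} (h : Overhang P Q d L) (h' : Overhang P' Q' e L)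
    (hy : ∀ j < L, y (d + j) = y (e + j)) :
    ∃ g : ℕ, 0 < g ∧ g ≤ L ∧ (∀ j < g, y (d + j) = y (e + j)) ∧
      ((CommonCut P Q (d + g) ∧ CommonCut P' Q' (e + g)) ∨
        ∃ L' : ℕ, (∀ j < L', y (d + g + j) = y (e + g + j)) ∧
          ((Overhang P Q (d + g) L' ∧ Overhang P' Q' (e + g) L') ∨
            Overhang Q P (d + g) L' ∧ Overhang Q' P' (e + g) L')) := by
  obtain ⟨a, ha⟩ := h.1
  obtain ⟨b, hb⟩ := h'.1
  obtain rfl := h.letter_eq hβ hne hP hQ hP' hQ' h' hy ha hb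
  have hpos := List.length_pos_iff.2 (hne a)
  rcases lt_trichotomy (β a).length L with hl | hl | hl
  · refine ⟨(β a).length, hpos, hl.le, fun j hj => hy j (by omega), Or.inr
      ⟨L - (β a).length, fun j hj => ?_, Or.inl ⟨h.step_lt hP ha hl, h'.step_lt hP' hb hl⟩⟩⟩
    have := hy ((β a).length + j) (by omega)
    push_cast at this
    rwa [← add_assoc, ← add_assoc] at this
  · refine ⟨L, h.2.2.1, le_rfl, hy, Or.inl ⟨⟨?_, h.2.1⟩, ?_, h'.2.1⟩⟩
    · rw [← hl]; exact hP.next d a ha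
    · rw [← hl]; exact hP'.next e a hb
  · refine ⟨L, h.2.2.1, le_rfl, hy, Or.inr ⟨(β a).length - L, fun j hj => ?_,
      Or.inr ⟨h.step_gt hP ha hl, h'.step_gt hP' hb hl⟩⟩⟩
    have h1 := hP.apply_eq ha (k := L + j) (by omega)
    have h2 := hP'.apply_eq hb (k := L + j) (by omega)
    have := h1.trans h2.symm
    push_cast at this
    rwa [← add_assoc, ← add_assoc] at this

/-- The version of `Overhang.step` for a pair of parses in which either may have the overhang. -/
theorem Overhang.step_pair [Finite C] (hβ : Elementary β) (hne : ∀ c, β c ≠ [])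
    (hP : IsParse β y P) (hQ : IsParse β y Q) {d e : ℤ} {L : ℕ}
    (h : Overhang P Q d L ∨ Overhang Q P d L) (h' : Overhang P Q e L ∨ Overhang Q P e L)
    (hy : ∀ j < L, y (d + j) = y (e + j)) :
    ∃ g : ℕ, 0 < g ∧ (∀ j < g, y (d + j) = y (e + j)) ∧
      (∀ i, d ≤ i → i < d + g → ¬ CommonCut P Q i) ∧
      (∀ i, e ≤ i → i < e + g → ¬ CommonCut P Q i) ∧
      ((CommonCut P Q (d + g) ∧ CommonCut P Q (e + g)) ∨
        ∃ L' : ℕ, (∀ j < L', y (d + g + j) = y (e + g + j)) ∧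
          (Overhang P Q (d + g) L' ∨ Overhang Q P (d + g) L') ∧
          (Overhang P Q (e + g) L' ∨ Overhang Q P (e + g) L')) := by
  have nc : ∀ {i j : ℤ} {g : ℕ}, g ≤ L → (Overhang P Q i L ∨ Overhang Q P i L) → i ≤ j →
      j < i + g → ¬ CommonCut P Q j := by
    rintro i j g hg (h | h) h1 h2 h3
    · exact h.not_commonCut h1 (by omega) h3
    · exact h.not_commonCut h1 (by omega) h3.symm
  have key : ∃ g : ℕ, 0 < g ∧ g ≤ L ∧ (∀ j < g, y (d + j) = y (e + j)) ∧
      ((CommonCut P Q (d + g) ∧ CommonCut P Q (e + g)) ∨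
        ∃ L' : ℕ, (∀ j < L', y (d + g + j) = y (e + g + j)) ∧
          (Overhang P Q (d + g) L' ∨ Overhang Q P (d + g) L') ∧
          (Overhang P Q (e + g) L' ∨ Overhang Q P (e + g) L')) := by
    rcases h with h | h <;> rcases h' with h' | h'
    · obtain ⟨g, h0, h1, h2, ⟨h3, h4⟩ | ⟨L', h3, ⟨h4, h5⟩ | ⟨h4, h5⟩⟩⟩ :=
        h.step hβ hne hP hQ hP hQ h' hy
      · exact ⟨g, h0, h1, h2, Or.inl ⟨h3, h4⟩⟩
      · exact ⟨g, h0, h1, h2, Or.inr ⟨L', h3, Or.inl h4, Or.inl h5⟩⟩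
      · exact ⟨g, h0, h1, h2, Or.inr ⟨L', h3, Or.inr h4, Or.inr h5⟩⟩
    · obtain ⟨g, h0, h1, h2, ⟨h3, h4⟩ | ⟨L', h3, ⟨h4, h5⟩ | ⟨h4, h5⟩⟩⟩ :=
        h.step hβ hne hP hQ hQ hP h' hy
      · exact ⟨g, h0, h1, h2, Or.inl ⟨h3, h4.symm⟩⟩
      · exact ⟨g, h0, h1, h2, Or.inr ⟨L', h3, Or.inl h4, Or.inr h5⟩⟩
      · exact ⟨g, h0, h1, h2, Or.inr ⟨L', h3, Or.inr h4, Or.inl h5⟩⟩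
    · obtain ⟨g, h0, h1, h2, ⟨h3, h4⟩ | ⟨L', h3, ⟨h4, h5⟩ | ⟨h4, h5⟩⟩⟩ :=
        h.step hβ hne hQ hP hP hQ h' hy
      · exact ⟨g, h0, h1, h2, Or.inl ⟨h3.symm, h4⟩⟩
      · exact ⟨g, h0, h1, h2, Or.inr ⟨L', h3, Or.inr h4, Or.inl h5⟩⟩
      · exact ⟨g, h0, h1, h2, Or.inr ⟨L', h3, Or.inl h4, Or.inr h5⟩⟩
    · obtain ⟨g, h0, h1, h2, ⟨h3, h4⟩ | ⟨L', h3, ⟨h4, h5⟩ | ⟨h4, h5⟩⟩⟩ :=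
        h.step hβ hne hQ hP hQ hP h' hy
      · exact ⟨g, h0, h1, h2, Or.inl ⟨h3.symm, h4.symm⟩⟩
      · exact ⟨g, h0, h1, h2, Or.inr ⟨L', h3, Or.inr h4, Or.inr h5⟩⟩
      · exact ⟨g, h0, h1, h2, Or.inr ⟨L', h3, Or.inl h4, Or.inl h5⟩⟩
  obtain ⟨g, h0, h1, h2, h3⟩ := key
  exact ⟨g, h0, h2, fun i => nc h1 h, fun i => nc h1 h', h3⟩

/-- Two parses of a non-periodic sequence by an elementary coding have common cuts arbitrarily
far to the left. -/
theorem exists_commonCut_le [Finite C] [Finite T] (hβ : Elementary β) (hne : ∀ c, β c ≠ [])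
    (hy : ¬ IsPeriodicSeq y) (hP : IsParse β y P) (hQ : IsParse β y Q) (i₀ : ℤ) :
    ∃ d ≤ i₀, CommonCut P Q d := by
  by_contra! hcon
  obtain ⟨M, hM⟩ := (Set.finite_range fun c => (β c).length).bddAbove
  -- A state is the overhang length together with a window of `M` symbols. As `M` bounds all word
  -- lengths, there are finitely many states and the window covers the overhang.
  let R : ℤ → Fin (M + 1) × (Fin M → T) → Prop := fun d s =>
    d ≤ i₀ ∧ (Overhang P Q d s.1 ∨ Overhang Q P d s.1) ∧ ∀ j : Fin M, y (d + (j : ℕ)) = s.2 j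
  have hR : ∀ i : ℤ, ∃ d ≤ i, ∃ s, R d s := by
    intro i
    obtain ⟨d, a, ha, hd⟩ := hP.exists_le (min i i₀)
    obtain ⟨e, b, hb, he, he'⟩ := hQ.exists_cover hne d
    have hlt : e < d := lt_of_le_of_ne he fun h =>
      hcon d (by omega) ⟨⟨a, ha⟩, b, h ▸ hb⟩
    have hMb : (β b).length ≤ M := hM ⟨b, rfl⟩
    refine ⟨d, by omega, (⟨(e + (β b).length - d).toNat, by omega⟩,
      fun j => y (d + (j : ℕ))), by omega, Or.inl ⟨⟨a, ha⟩, ?_, ?_, ?_⟩, fun j => rfl⟩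
    · obtain ⟨b', hb'⟩ := hQ.next e b hb
      refine ⟨b', ?_⟩
      have h1 : d + (((e + (β b).length - d).toNat : ℕ) : ℤ) = e + (β b).length := by omega
      simpa only [h1] using hb'
    · change 0 < (e + (β b).length - d).toNat
      omega
    · intro k c hc hk
      have := hQ.gap e b k c hb hc (by omega)
      change d + (((e + (β b).length - d).toNat : ℕ) : ℤ) ≤ k
      omega
  obtain ⟨s, hs⟩ := exists_state_unbounded hR
  have hagree : ∀ d e, R d s → R e s → ∀ j < (s.1 : ℕ), y (d + j) = y (e + j) := by
    intro d e hd he j hj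
    have := s.1.2
    rw [hd.2.2 ⟨j, by omega⟩, he.2.2 ⟨j, by omega⟩]
  by_cases hc : ∃ c, CommonCut P Q c
  · obtain ⟨c, hc, hmin⟩ := Int.exists_least_of_bdd (P := CommonCut P Q)
      ⟨i₀, fun z hz => le_of_lt (not_le.1 fun h => hcon z h hz)⟩ hc
    have hci : i₀ < c := not_le.1 fun h => hcon c h hc
    obtain ⟨e, -, he⟩ := hs i₀
    obtain ⟨d, hde, hd⟩ := hs (e - 1)
    -- Let `c` be the leftmost common cut and follow the two occurrences of the state in parallel.
    -- The right one never skips `c`, and when it arrives there the left one is also at a common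
    -- cut, strictly left of `c`.
    have key : ∀ (n : ℕ) (d e : ℤ) (L : ℕ), (c - d).toNat = n → d < e → e < c →
        (Overhang P Q d L ∨ Overhang Q P d L) → (Overhang P Q e L ∨ Overhang Q P e L) →
        (∀ j < L, y (d + j) = y (e + j)) → False := by
      intro n
      induction n using Nat.strong_induction_on with
      | _ n ih =>
        intro d e L hn hde hec hd he hj
        obtain ⟨g, hg, -, h1, h2, h3⟩ := Overhang.step_pair hβ hne hP hQ hd he hj
        have h4 : ¬ c < e + g := fun h => h2 c hec.le h hc
        rcases h3 with ⟨h3, -⟩ | ⟨L', h3, h5, h6⟩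
        · have := hmin _ h3
          omega
        · have h7 : e + g ≠ c := by
            intro h
            rcases h6 with h6 | h6
            · exact h6.not_commonCut le_rfl (by have := h6.2.2.1; omega) (h ▸ hc)
            · exact h6.not_commonCut le_rfl (by have := h6.2.2.1; omega) (h ▸ hc.symm)
          exact ih _ (by omega) (d + g) (e + g) L' rfl (by omega) (by omega) h5 h6 h3
    exact key _ d e s.1 rfl (by omega) (by have := he.1; omega) hd.2.1 he.2.1 (hagree d e hd he)
  -- Without any common cut the parallel run never stops, so all tails at occurrences of the state
  -- agree.
  · refine hy (isPeriodicSeq_of_tails (fun d => R d s) hs fun d e hd he t => ?_)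
    have key : ∀ (t : ℕ) (d e : ℤ) (L : ℕ),
        (Overhang P Q d L ∨ Overhang Q P d L) → (Overhang P Q e L ∨ Overhang Q P e L) →
        (∀ j < L, y (d + j) = y (e + j)) → y (d + t) = y (e + t) := by
      intro t
      induction t using Nat.strong_induction_on with
      | _ t ih =>
        intro d e L hd he hj
        obtain ⟨g, hg, h0, -, -, h3⟩ := Overhang.step_pair hβ hne hP hQ hd he hj
        by_cases ht : t < g
        · exact h0 t ht
        rcases h3 with ⟨h3, -⟩ | ⟨L', h3, h5, h6⟩
        · exact absurd ⟨_, h3⟩ hc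
        · have := ih (t - g) (by omega) (d + g) (e + g) L' h5 h6 h3
          have a : ∀ i : ℤ, i + g + ((t - g : ℕ) : ℤ) = i + t := fun i => by omega
          rwa [a, a] at this
    exact key t d e s.1 hd.2.1 he.2.1 (hagree d e hd he)

end Recognizability

/-! ### Lifting sequences through an elementary projection. -/

section Lift
variable {C T T' : Type} {β : C → List T'} {p : T' → T} {w w' : ℤ → T'} {P Q : ℤ → C → Prop}

/-- If the projection of a coding is elementary, then tails of coded sequences are determined by
their projections. -/
theorem lift_tail_eq [Finite C] (hβ : Elementary fun c => (β c).map p) (hne : ∀ c, β c ≠ [])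
    (hP : IsParse β w P) (hQ : IsParse β w' Q) (t : ℕ) :
    ∀ {d e : ℤ} {a b : C}, P d a → Q e b →
      tailAt (fun i => p (w i)) d = tailAt (fun i => p (w' i)) e → w (d + t) = w' (e + t) := by
  induction t using Nat.strong_induction_on with
  | _ t ih =>
    intro d e a b ha hb h
    have h1 := (hP.map p).firstLetter ha
    have h2 := (hQ.map p).firstLetter hb
    rw [← h] at h2
    obtain rfl : a = b := hβ.firstLetter_eq (by simpa using hne) ⟨_, h1, h2⟩
    by_cases ht : t < (β a).length
    · rw [hP.apply_eq ha ht, hQ.apply_eq hb ht]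
    · obtain ⟨a', ha'⟩ := hP.next d a ha
      obtain ⟨b', hb'⟩ := hQ.next e a hb
      have hpos := List.length_pos_iff.2 (hne a)
      have := ih (t - (β a).length) (by omega) ha' hb' (tailAt_add h _)
      have a : ∀ i : ℤ, i + (β a).length + ((t - (β a).length : ℕ) : ℤ) = i + t :=
        fun i => by omega
      rwa [a, a] at this

/-- Cuts in one residue class modulo a period of the projection occur arbitrarily far to the left.
The projected tails at these cuts agree, hence so do the tails of `w` by `lift_tail_eq`. -/
theorem IsPeriodicSeq.lift [Finite C] (hβ : Elementary fun c => (β c).map p)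
    (hne : ∀ c, β c ≠ []) (hP : IsParse β w P) (h : IsPeriodicSeq fun i => p (w i)) :
    IsPeriodicSeq w := by
  obtain ⟨q, hq, hper⟩ := h
  have : NeZero q := ⟨hq.ne'⟩
  have hmul : ∀ (k : ℕ) (s : ℤ), p (w (s + q * k)) = p (w s) := by
    intro k
    induction k with
    | zero => simp
    | succ k ih =>
      intro s
      have h1 : p (w (s + q * k + q)) = p (w (s + q * k)) := hper (s + q * k)
      rw [← ih s, ← h1]
      push_cast
      ring_nf
  obtain ⟨s, hs⟩ := exists_state_unbounded (R := fun d (s : ZMod q) => (∃ a, P d a) ∧ (d : ZMod q) = s)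
    (fun i => by
      obtain ⟨d, a, ha, hd⟩ := hP.exists_le i
      exact ⟨d, hd, _, ⟨a, ha⟩, rfl⟩)
  have hle : ∀ d e : ℤ, d ≤ e → (d : ZMod q) = e →
      tailAt (fun i => p (w i)) d = tailAt (fun i => p (w i)) e := by
    intro d e hde h
    obtain ⟨k, hk⟩ := (ZMod.intCast_eq_intCast_iff_dvd_sub d e q).1 h
    have hk0 : 0 ≤ k := by
      by_contra! hlt
      nlinarith
    obtain ⟨k, rfl⟩ := Int.eq_ofNat_of_zero_le hk0
    rw [tailAt_eq_iff]
    intro t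
    rw [← hmul k (d + t)]
    congr 2
    linarith
  refine isPeriodicSeq_of_tails _ hs ?_
  rintro d e ⟨⟨a, ha⟩, hd⟩ ⟨⟨b, hb⟩, he⟩ t
  refine lift_tail_eq hβ hne hP hP t ha hb ?_
  rcases le_total d e with hde | hde
  · exact hle d e hde (hd.trans he.symm)
  · exact (hle e d hde (he.trans hd.symm)).symm

/-- If the projection of a coding is elementary, then coded sequences with the same non-periodic
projection are equal. -/
theorem lift_eq [Finite C] [Finite T] (hβ : Elementary fun c => (β c).map p)
    (hne : ∀ c, β c ≠ []) (hP : IsParse β w P) (hQ : IsParse β w' Q)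
    (hy : ¬ IsPeriodicSeq fun i => p (w i)) (h : ∀ i, p (w i) = p (w' i)) : w = w' := by
  have h' : (fun i => p (w i)) = fun i => p (w' i) := funext h
  funext i
  have hQ' := hQ.map p
  rw [← h'] at hQ'
  obtain ⟨d, hd, ⟨a, ha⟩, b, hb⟩ := exists_commonCut_le hβ (by simpa using hne) hy
    (hP.map p) hQ' i
  have := lift_tail_eq hβ hne hP hQ (i - d).toNat ha hb (by rw [h'])
  have e : d + ((i - d).toNat : ℤ) = i := by omega
  rwa [e] at this

end Lift

/-! ### Codes, periodic itineraries and odometers. -/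

/-- The periods of a periodic two-sided sequence are the multiples of one positive integer. -/
theorem IsPeriodicSeq.exists_minimal_period {T : Type} {y : ℤ → T} (h : IsPeriodicSeq y) :
    ∃ q : ℕ, 0 < q ∧ ∀ k : ℤ, (∀ i, y (i + k) = y i) ↔ (q : ℤ) ∣ k := by
  let H : AddSubgroup ℤ :=
    { carrier := {k | ∀ i, y (i + k) = y i}
      zero_mem' := fun i => by simp
      add_mem' := fun {a b} ha hb i => by
        rw [← add_assoc]
        exact (hb (i + a)).trans (ha i)
      neg_mem' := fun {a} ha i => by
        have := ha (i + -a)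
        rw [neg_add_cancel_right] at this
        exact this.symm }
  have hH : ∀ k, k ∈ H ↔ ∀ i, y (i + k) = y i := fun k => Iff.rfl
  obtain ⟨a, ha⟩ := Int.subgroup_cyclic H
  have hdvd : ∀ k, (∀ i, y (i + k) = y i) ↔ (a.natAbs : ℤ) ∣ k := by
    intro k
    rw [← hH, ha, AddSubgroup.mem_closure_singleton, Int.natAbs_dvd]
    exact ⟨fun ⟨n, hn⟩ => ⟨n, by rw [← hn, smul_eq_mul, mul_comm]⟩,
      fun ⟨n, hn⟩ => ⟨n, by rw [hn, smul_eq_mul, mul_comm]⟩⟩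
  refine ⟨a.natAbs, Nat.pos_of_ne_zero fun h0 => ?_, hdvd⟩
  obtain ⟨p, hp, hper⟩ := h
  have := (hdvd p).1 hper
  rw [h0] at this
  simp at this
  omega

/-- Finer and finer finite clopen partitions of `X` (given by the fibres of the maps `code n`)
that separate points. -/
structure IsCodeTower {X : Type*} [TopologicalSpace X] {T : ℕ → Type}
    (code : ∀ n, X → T n) : Prop where
  finite : ∀ n, Finite (T n)
  isClosed : ∀ n t, IsClosed {x | code n x = t}
  proj : ∀ m n, m ≤ n → ∃ p : T n → T m, ∀ x, code m x = p (code n x)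
  sep : ∀ x y, (∀ n, code n x = code n y) → x = y

section CodeTower
variable {X : Type*} [TopologicalSpace X] {f : X ≃ₜ X} {T : ℕ → Type} {code : ∀ n, X → T n}

theorem zpow_apply_add (f : X ≃ₜ X) (i j : ℤ) (x : X) : (f ^ (i + j)) x = (f ^ i) ((f ^ j) x) := by
  rw [zpow_add]; rfl

theorem apply_zpow_apply (f : X ≃ₜ X) (i : ℤ) (x : X) : f ((f ^ i) x) = (f ^ (i + 1)) x := by
  rw [add_comm, zpow_apply_add, zpow_one]

/-- The sequence of codes along the orbit of a point. -/
def itinerary (f : X ≃ₜ X) (code : ∀ n, X → T n) (n : ℕ) (x : X) : ℤ → T n :=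
  fun i => code n ((f ^ i) x)

theorem itinerary_zpow (n : ℕ) (x : X) (i k : ℤ) :
    itinerary f code n ((f ^ k) x) i = itinerary f code n x (i + k) := by
  simp only [itinerary, zpow_apply_add]

theorem itinerary_zero (n : ℕ) (x : X) : itinerary f code n x 0 = code n x := by
  simp [itinerary]

theorem IsCodeTower.itinerary_eq_of_le (hc : IsCodeTower code) {m n : ℕ} (h : m ≤ n) {x y : X}
    {i j : ℤ} (he : itinerary f code n x i = itinerary f code n y j) :
    itinerary f code m x i = itinerary f code m y j := by
  obtain ⟨p, hp⟩ := hc.proj m n h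
  simp only [itinerary, hp] at he ⊢
  rw [he]

theorem IsCodeTower.eq_of_itinerary (hc : IsCodeTower code) {x y : X}
    (h : ∀ n i, itinerary f code n x i = itinerary f code n y i) : x = y :=
  hc.sep x y fun n => by simpa [itinerary_zero] using h n 0

theorem IsCodeTower.isClosed_itinerary (hc : IsCodeTower code) (n : ℕ) (y : ℤ → T n) :
    IsClosed {x | ∀ i, itinerary f code n x i = y i} := by
  simp only [ofPred_forall]
  exact isClosed_iInter fun i => (hc.isClosed n (y i)).preimage (f ^ i).continuous

/-- A point that is not periodic although all its itineraries are periodic generates an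
odometer. -/
theorem IsCodeTower.exists_odometer [CompactSpace X] (hc : IsCodeTower code) {x : X}
    (hper : ∀ n, IsPeriodicSeq (itinerary f code n x))
    (hx : ∀ p : ℕ, 0 < p → (f ^ (p : ℤ)) x ≠ x) : ∃ M, IsMinimalSet f M ∧ IsOdometerOn f M := by
  set Y : ∀ n, ℤ → T n := fun n => itinerary f code n x with hY
  choose q hq hdvd using fun n => (hper n).exists_minimal_period
  have hYcast : ∀ n (a b : ℤ), (∀ i, Y n (i + a) = Y n (i + b)) ↔ (a : ZMod (q n)) = b := by
    intro n a b
    rw [eq_comm, ZMod.intCast_eq_intCast_iff_dvd_sub, ← hdvd]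
    constructor
    · intro h i
      have := h (i - b)
      rwa [sub_add_cancel, show i - b + a = i + (a - b) by ring] at this
    · intro h i
      exact (congrArg (Y n) (by ring : i + a = i + b + (a - b))).trans (h (i + b))
  have hdvd' : ∀ n, q n ∣ q (n + 1) := by
    intro n
    rw [← Int.natCast_dvd_natCast, ← hdvd]
    intro i
    exact hc.itinerary_eq_of_le n.le_succ (((hdvd (n + 1) _).2 dvd_rfl) i)
  let S : OdometerScale :=
    { q := q
      pos := hq
      dvd := hdvd'
      unbounded := by
        intro N
        by_contra! hcon
        -- If all minimal periods were at most `N`, then `N!` would be a period at every level, and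
        -- `x` would be a periodic point.
        refine hx N.factorial N.factorial_pos (hc.sep _ _ fun n => ?_)
        have h1 : (q n : ℤ) ∣ (N.factorial : ℕ) :=
          Int.natCast_dvd_natCast.2 (Nat.dvd_factorial (hq n) (hcon n))
        have h2 := (hdvd n _).2 h1 0
        rw [zero_add] at h2
        simpa [hY, itinerary] using h2 }
  -- This is the candidate for the orbit closure of `x`: at every level the itinerary is a shift of
  -- that of `x`, with the shift depending on the level.
  let M : Set X := {z | ∀ n, ∃ t : ℤ, ∀ i, itinerary f code n z i = Y n (i + t)}
  have hne : ∀ n, NeZero (q n) := fun n => ⟨(hq n).ne'⟩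
  have hMclosed : IsClosed M := by
    have : M = ⋂ n, ⋃ c : ZMod (q n),
        {z | ∀ i, itinerary f code n z i = Y n (i + (c.cast : ℤ))} := by
      ext z
      simp only [M, mem_ofPred_eq, mem_iInter, mem_iUnion]
      refine forall_congr' fun n => ⟨fun ⟨t, ht⟩ => ⟨t, fun i => ?_⟩, fun ⟨c, hc⟩ => ⟨_, hc⟩⟩
      rw [ht i]
      exact (hYcast n _ _).2 (by simp) i
    rw [this]
    exact isClosed_iInter fun n => isClosed_iUnion_of_finite fun c => hc.isClosed_itinerary n _
  have hMf : ∀ (k : ℤ) z, z ∈ M → (f ^ k) z ∈ M := by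
    intro k z hz n
    obtain ⟨t, ht⟩ := hz n
    refine ⟨k + t, fun i => ?_⟩
    rw [itinerary_zpow, ht, add_assoc]
  have hxM : x ∈ M := fun n => ⟨0, fun i => by simp [hY]⟩
  have hinv : f '' M = M := by
    refine Subset.antisymm ?_ fun z hz => ⟨(f ^ (-1 : ℤ)) z, hMf _ z hz, ?_⟩
    · rintro _ ⟨z, hz, rfl⟩
      simpa using hMf 1 z hz
    · rw [apply_zpow_apply]; simp
  have hmin : IsMinimalSet f M := by
    refine ⟨⟨⟨x, hxM⟩, hMclosed, hinv⟩, ?_⟩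
    rintro N ⟨⟨y, hy⟩, hN, hfN⟩ hNM z hz
    have hNf : ∀ (k : ℕ), (f ^ (k : ℤ)) y ∈ N := by
      intro k
      induction k with
      | zero => simpa using hy
      | succ k ih =>
        push_cast
        rw [← apply_zpow_apply, ← hfN]
        exact mem_image_of_mem f ih
    -- At each level some forward iterate of `y` has the code of `z`, since shifts matter only
    -- modulo `q n`; compactness then puts `z` itself into `N`.
    have hnon : (⋂ n, N ∩ {w | code n w = code n z}).Nonempty := by
      refine IsCompact.nonempty_iInter_of_sequence_nonempty_isCompact_isClosed _ ?_ ?_ ?_ ?_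
      · rintro n w ⟨h1, h2⟩
        refine ⟨h1, ?_⟩
        obtain ⟨p, hp⟩ := hc.proj n (n + 1) n.le_succ
        rw [mem_ofPred_eq] at h2 ⊢
        rw [hp, hp, h2]
      · intro n
        obtain ⟨a, ha⟩ := hNM hy n
        obtain ⟨b, hb⟩ := hz n
        obtain ⟨k, hk⟩ : ∃ k : ℕ, ((a + k : ℤ) : ZMod (q n)) = b :=
          ⟨((b - a : ℤ) : ZMod (q n)).val, by simp⟩
        refine ⟨_, hNf k, ?_⟩
        have h1 := ha (0 + k)
        have h2 := hb 0
        rw [← itinerary_zpow, itinerary_zero] at h1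
        rw [itinerary_zero] at h2
        rw [mem_ofPred_eq, h1, h2, add_assoc, add_comm (k : ℤ) a]
        exact (hYcast n _ _).2 hk 0
      · exact (hN.inter (hc.isClosed 0 _)).isCompact
      · exact fun n => hN.inter (hc.isClosed n _)
    obtain ⟨w, hw⟩ := hnon
    rw [mem_iInter] at hw
    rw [← hc.sep w z fun n => (hw n).2]
    exact (hw 0).1
  refine ⟨M, hmin, ?_⟩
  choose t ht using fun (z : M) => z.2
  -- The chosen shift is unique modulo the minimal period, so its residues are canonical coordinates
  -- of `z`.
  have huniq : ∀ (z : M) n (a : ℤ), (∀ i, itinerary f code n z i = Y n (i + a)) →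
      (t z n : ZMod (q n)) = a := by
    intro z n a ha
    rw [← hYcast]
    intro i
    rw [← ht z n i, ha]
  let g : M → S.Space := fun z => ⟨fun n => (t z n : ZMod (q n)), fun n => by
    change ZMod.castHom (hdvd' n) (ZMod (q n)) ((t z (n + 1) : ℤ) : ZMod (q (n + 1))) = _
    rw [map_intCast]
    refine (huniq z n _ fun i => ?_).symm
    rw [← hY] at *
    have h1 := ht z (n + 1) i
    have h2 : itinerary f code (n + 1) z i = itinerary f code (n + 1) x (i + t z (n + 1)) := h1
    exact hc.itinerary_eq_of_le n.le_succ h2⟩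
  have hg : ∀ z n, (g z).1 n = (t z n : ZMod (q n)) := fun z n => rfl
  have hgcont : Continuous g := by
    refine Continuous.subtype_mk (continuous_pi fun n => ?_) _
    rw [continuous_iff_isClosed]
    intro s _
    have : (fun z : M => (t z n : ZMod (q n))) ⁻¹' s = ⋃ c : s, (Subtype.val : M → X) ⁻¹'
        {z | ∀ i, itinerary f code n z i = Y n (i + (c.1.cast : ℤ))} := by
      ext z
      simp only [mem_preimage, mem_iUnion, mem_ofPred_eq]
      constructor
      · intro h
        refine ⟨⟨_, h⟩, fun i => ?_⟩
        rw [ht z n i]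
        exact (hYcast n _ _).2 (by simp) i
      · rintro ⟨c, hc⟩
        have := huniq z n _ hc
        rw [this]
        simp
    rw [this]
    exact isClosed_iUnion_of_finite fun c =>
      (hc.isClosed_itinerary n _).preimage continuous_subtype_val
  have hginj : Function.Injective g := by
    intro z w hzw
    refine Subtype.ext (hc.eq_of_itinerary (f := f) fun n i => ?_)
    rw [ht z n i, ht w n i]
    refine (hYcast n _ _).2 ?_ i
    rw [← hg, ← hg, hzw]
  have hgsurj : Function.Surjective g := by
    intro s
    -- Each of these nested closed sets contains a shift of `x`, so a point with all the prescribed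
    -- residues exists by compactness.
    have hnon : (⋂ n, {z | ∀ i, itinerary f code n z i = Y n (i + ((s.1 n).cast : ℤ))}).Nonempty := by
      refine IsCompact.nonempty_iInter_of_sequence_nonempty_isCompact_isClosed _ ?_ ?_ ?_ ?_
      · intro n w hw i
        have h1 : itinerary f code (n + 1) w i = itinerary f code (n + 1) x _ := hw i
        refine (hc.itinerary_eq_of_le n.le_succ h1).trans ((hYcast n _ _).2 ?_ i)
        have h2 := s.2 n
        rw [← ZMod.intCast_zmod_cast (s.1 (n + 1)), map_intCast] at h2
        refine h2.trans ?_
        exact (ZMod.intCast_zmod_cast _).symm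
      · exact fun n => ⟨_, fun i => itinerary_zpow n x i _⟩
      · exact (hc.isClosed_itinerary 0 _).isCompact
      · exact fun n => hc.isClosed_itinerary n _
    obtain ⟨w, hw⟩ := hnon
    rw [mem_iInter] at hw
    refine ⟨⟨w, fun n => ⟨_, hw n⟩⟩, Subtype.ext (funext fun n => ?_)⟩
    rw [hg, huniq ⟨w, fun n => ⟨_, hw n⟩⟩ n _ (hw n)]
    exact ZMod.intCast_zmod_cast _
  have : CompactSpace M := isCompact_iff_compactSpace.1 hMclosed.isCompact
  let e : M ≃ S.Space := Equiv.ofBijective g ⟨hginj, hgsurj⟩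
  have hT2 : T2Space S.Space := by
    have : ∀ n, DiscreteTopology (ZMod (S.q n)) := fun n => inferInstance
    infer_instance
  let h : M ≃ₜ S.Space := Continuous.homeoOfEquivCompactToT2 (f := e) hgcont
  have hfg : ∀ z : M, g ⟨f z, by simpa using hMf 1 z z.2⟩ = S.addOne (g z) := by
    intro z
    refine Subtype.ext (funext fun n => ?_)
    rw [hg]
    have := huniq ⟨f z, by simpa using hMf 1 z z.2⟩ n (t z n + 1) fun i => by
      have h1 := ht z n (i + 1)
      rw [← itinerary_zpow, zpow_one] at h1
      exact h1.trans (congrArg (Y n) (by ring))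
    rw [this]
    push_cast
    rfl
  refine ⟨S, h.symm, fun s => ?_⟩
  obtain ⟨z, rfl⟩ := h.surjective s
  have h1 : S.addOne (h z) = h ⟨f z, by simpa using hMf 1 z z.2⟩ := (hfg z).symm
  rw [h1, h.symm_apply_apply, h.symm_apply_apply]

end CodeTower

/-! ### Bounded numbers of words and a generating level. -/

section Generating
variable {X : Type*} [TopologicalSpace X] {f : X ≃ₜ X} {T : ℕ → Type} {code : ∀ n, X → T n}

/-- At level `n`, all itineraries are concatenations of at most `k` words. -/
def Codable (f : X ≃ₜ X) (code : ∀ n, X → T n) (n k : ℕ) : Prop :=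
  ∃ (C : Type) (_ : Finite C) (β : C → List (T n)), Nat.card C ≤ k ∧ (∀ c, β c ≠ []) ∧
    ∀ x, ∃ P, IsParse β (itinerary f code n x) P

theorem IsCodeTower.itinerary_proj (hc : IsCodeTower code) {m n : ℕ} (h : m ≤ n) :
    ∃ p : T n → T m, ∀ x : X,
      itinerary f code m x = fun i => p (itinerary f code n x i) := by
  obtain ⟨p, hp⟩ := hc.proj m n h
  exact ⟨p, fun x => funext fun i => hp _⟩

/-- Projecting the words symbol by symbol keeps all cuts, so a bound descends to lower levels. -/
theorem Codable.of_le (hc : IsCodeTower code) {m n k : ℕ} (hmn : m ≤ n)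
    (h : Codable f code n k) : Codable f code m k := by
  obtain ⟨C, hC, β, hk, hne, hP⟩ := h
  obtain ⟨p, hp⟩ := hc.itinerary_proj (f := f) hmn
  refine ⟨C, hC, fun c => (β c).map p, hk, by simpa using hne, fun x => ?_⟩
  obtain ⟨P, hP⟩ := hP x
  exact ⟨P, by rw [hp]; exact hP.map p⟩

/-- From some level on, all itineraries of higher level are coded in a way that is elementary at
the lower level. -/
theorem IsCodeTower.exists_elementary (hc : IsCodeTower code) {K : ℕ}
    (hK : ∃ᶠ n in atTop, Codable f code n K) :
    ∃ m₀, ∀ m ≥ m₀, ∀ n ≥ m, ∃ (C : Type) (_ : Finite C) (β : C → List (T n)) (p : T n → T m),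
      (∀ c, β c ≠ []) ∧ (∀ x, ∃ P, IsParse β (itinerary f code n x) P) ∧
      (∀ x, itinerary f code m x = fun i => p (itinerary f code n x i)) ∧
      Elementary fun c => (β c).map p := by
  classical
  have hall : ∃ k, ∀ n, Codable f code n k := by
    refine ⟨K, fun n => ?_⟩
    obtain ⟨n', hn', h⟩ := (frequently_atTop.1 hK) n
    exact h.of_le hc hn'
  let r := Nat.find hall
  have hr : ∀ n, Codable f code n r := Nat.find_spec hall
  -- By minimality of `r` some level needs `r` words, and then so does every higher level. A
  -- factorization of the projected words through fewer letters would contradict this.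
  obtain ⟨m₀, hm₀⟩ : ∃ m₀, ∀ k < r, ¬ Codable f code m₀ k := by
    rcases Nat.eq_zero_or_pos r with h0 | hpos
    · exact ⟨0, fun k hk => by omega⟩
    · have := Nat.find_min hall (show r - 1 < r by omega)
      push Not at this
      obtain ⟨m₀, hm₀⟩ := this
      refine ⟨m₀, fun k hk ⟨C, hC, β, h1, h2⟩ => hm₀ ⟨C, hC, β, by omega, h2⟩⟩
  refine ⟨m₀, fun m hm n hn => ?_⟩
  obtain ⟨C, hC, β, hk, hne, hP⟩ := hr n
  obtain ⟨p, hp⟩ := hc.itinerary_proj (f := f) hn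
  refine ⟨C, hC, β, p, hne, hP, hp, ?_⟩
  rintro k ⟨D, hD, α, β', hDk, hne', hβ'⟩
  by_contra! hlt
  refine hm₀ k (by omega) (Codable.of_le hc hm ⟨D, hD, β', hDk, hne', fun x => ?_⟩)
  obtain ⟨P, hP⟩ := hP x
  have h1 := hP.map p
  rw [hp]
  exact h1.refine (by simpa using hne) hne' hβ'

theorem IsCodeTower.eventually_injOn (hc : IsCodeTower code) {S : Set X} (hS : S.Finite) :
    ∀ᶠ n in atTop, InjOn (code n) S := by
  have h : ∀ z ∈ S ×ˢ S, ∀ᶠ n in atTop, code n z.1 = code n z.2 → z.1 = z.2 := by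
    rintro ⟨x, y⟩ -
    by_cases hxy : x = y
    · exact Eventually.of_forall fun _ _ => hxy
    · obtain ⟨n, hn⟩ : ∃ n, code n x ≠ code n y := by
        by_contra! h
        exact hxy (hc.sep x y h)
      filter_upwards [eventually_ge_atTop n] with n' hn' he
      obtain ⟨p, hp⟩ := hc.proj n n' hn'
      exact absurd (by rw [hp, hp]; exact congrArg p he) hn
  have := (Filter.eventually_all_finite (hS.prod hS)).2 h
  filter_upwards [this] with n hn x hx y hy he
  exact hn (x, y) ⟨hx, hy⟩ he

theorem finite_orbit {x : X} {p : ℕ} (hp : 0 < p) (hx : (f ^ (p : ℤ)) x = x) :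
    (range fun i : ℤ => (f ^ i) x).Finite := by
  have hmul : ∀ k : ℤ, (f ^ ((p : ℤ) * k)) x = x := by
    intro k
    rw [zpow_mul]
    have h1 : ∀ k : ℕ, ((f ^ (p : ℤ)) ^ k) x = x := by
      intro k
      induction k with
      | zero => simp
      | succ k ih =>
        rw [pow_succ]
        change ((f ^ (p : ℤ)) ^ k) ((f ^ (p : ℤ)) x) = x
        rw [hx, ih]
    obtain ⟨k, rfl | rfl⟩ := k.eq_nat_or_neg
    · simpa using h1 k
    · rw [zpow_neg, zpow_natCast]
      change ((f ^ (p : ℤ)) ^ k).symm x = x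
      rw [Homeomorph.symm_apply_eq, h1 k]
  refine ((Set.finite_Ico (0 : ℤ) p).image fun i => (f ^ i) x).subset ?_
  rintro _ ⟨i, rfl⟩
  refine ⟨i % p, ⟨Int.emod_nonneg _ (by omega), Int.emod_lt_of_pos _ (by omega)⟩, ?_⟩
  conv_rhs => rw [← Int.emod_add_mul_ediv i p]
  change _ = (f ^ (i % p + p * (i / p))) x
  rw [zpow_apply_add, hmul]

/-- There are only finitely many periodic points. -/
theorem IsCodeTower.finite_periodic (hc : IsCodeTower code) {K : ℕ}
    (hK : ∃ᶠ n in atTop, Codable f code n K) :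
    {x : X | ∃ p : ℕ, 0 < p ∧ (f ^ (p : ℤ)) x = x}.Finite := by
  classical
  let orb : X → Set X := fun x => range fun i : ℤ => (f ^ i) x
  set Per := {x : X | ∃ p : ℕ, 0 < p ∧ (f ^ (p : ℤ)) x = x}
  have hself : ∀ x, x ∈ orb x := fun x => ⟨0, by simp⟩
  have horb : ∀ x y, y ∈ orb x → orb y = orb x := by
    rintro x _ ⟨i, rfl⟩
    refine Subset.antisymm ?_ ?_
    · rintro _ ⟨j, rfl⟩
      exact ⟨j + i, zpow_apply_add f j i x⟩
    · rintro _ ⟨j, rfl⟩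
      refine ⟨j - i, ?_⟩
      change (f ^ (j - i)) ((f ^ i) x) = (f ^ j) x
      rw [← zpow_apply_add, sub_add_cancel]
  have hfin : (orb '' Per).Finite := by
    by_contra hinf
    obtain ⟨F, hF, hFcard⟩ := Set.Infinite.exists_subset_card_eq hinf (K + 1)
    have hU : (⋃₀ (F : Set (Set X))).Finite := by
      refine F.finite_toSet.sUnion fun O hO => ?_
      obtain ⟨x, ⟨p, hp, hx⟩, rfl⟩ := hF hO
      exact finite_orbit hp hx
    obtain ⟨n, ⟨C, hC, β, hCK, hne, hP⟩, hinj⟩ := (hK.and_eventually (hc.eventually_injOn hU)).exists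
    -- Each of the `K + 1` orbits uses some word, whose first symbol is the code of a point of the
    -- orbit. As this code separates the points of all chosen orbits, different orbits use different
    -- words.
    have hcut : ∀ O : F, ∃ c, ∃ z ∈ O.1, some (code n z) = (β c).head? := by
      rintro ⟨O, hO⟩
      obtain ⟨x, hx, rfl⟩ := hF hO
      obtain ⟨P, hP⟩ := hP x
      obtain ⟨d, a, ha, -⟩ := hP.exists_le 0
      refine ⟨a, (f ^ d) x, ⟨d, rfl⟩, ?_⟩
      have h1 := hP.apply_eq ha (List.length_pos_iff.2 (hne a))
      rw [List.head?_eq_getElem?, List.getElem?_eq_getElem (List.length_pos_iff.2 (hne a)), ← h1]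
      simp [itinerary]
    choose c z hz hcz using hcut
    have hcinj : Function.Injective c := by
      intro O O' h
      have h1 : code n (z O) = code n (z O') :=
        Option.some_injective _ ((hcz O).trans ((congrArg (fun a => (β a).head?) h).trans
          (hcz O').symm))
      have h2 := hinj ⟨_, O.2, hz O⟩ ⟨_, O'.2, hz O'⟩ h1
      obtain ⟨x, -, hx⟩ := hF O.2
      obtain ⟨x', -, hx'⟩ := hF O'.2
      have e1 := horb x (z O) (hx ▸ hz O)
      have e2 := horb x' (z O') (hx' ▸ hz O')
      refine Subtype.ext ?_
      rw [← hx, ← hx', ← e1, ← e2, h2]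
    have := Nat.card_le_card_of_injective c hcinj
    rw [Nat.card_eq_fintype_card, Fintype.card_coe, hFcard] at this
    omega
  refine (hfin.sUnion ?_).subset fun x hx => ⟨_, mem_image_of_mem _ hx, hself x⟩
  rintro _ ⟨x, ⟨p, hp, hx⟩, rfl⟩
  exact finite_orbit hp hx

/-- A tower of codes of finite rank without odometers has a generating level. -/
theorem IsCodeTower.exists_generating [CompactSpace X] (hc : IsCodeTower code) {K : ℕ}
    (hK : ∃ᶠ n in atTop, Codable f code n K)
    (hodo : ∀ M : Set X, IsMinimalSet f M → ¬ IsOdometerOn f M) :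
    ∃ m, ∀ x y : X, itinerary f code m x = itinerary f code m y → x = y := by
  obtain ⟨m₀, hm₀⟩ := hc.exists_elementary hK
  -- The level must be high enough for elementarity and for separating the finitely many periodic
  -- points.
  obtain ⟨m, hinj, hm⟩ := ((hc.eventually_injOn (hc.finite_periodic hK)).and
    (eventually_ge_atTop m₀)).exists
  refine ⟨m, fun x y hxy => ?_⟩
  by_cases hper : IsPeriodicSeq (itinerary f code m x)
  · have hPer : ∀ z, IsPeriodicSeq (itinerary f code m z) →
        ∃ p : ℕ, 0 < p ∧ (f ^ (p : ℤ)) z = z := by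
      intro z hz
      by_contra! hcon
      -- Periodicity at level `m` lifts to level `max m n` and projects down to level `n`.
      have hall : ∀ n, IsPeriodicSeq (itinerary f code n z) := by
        intro n
        obtain ⟨C, hC, β, p, hne, hP, hp, hel⟩ := hm₀ m hm (max m n) (le_max_left _ _)
        obtain ⟨P, hP⟩ := hP z
        rw [hp] at hz
        obtain ⟨k, hk, hk'⟩ := IsPeriodicSeq.lift hel hne hP hz
        exact ⟨k, hk, fun s => hc.itinerary_eq_of_le (le_max_right m n) (hk' s)⟩
      obtain ⟨M, hM, hM'⟩ := hc.exists_odometer hall hcon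
      exact hodo M hM hM'
    refine hinj (hPer x hper) (hPer y (hxy ▸ hper)) ?_
    simpa [itinerary_zero] using congrFun hxy 0
  · refine hc.sep x y fun n => ?_
    obtain ⟨C, hC, β, p, hne, hP, hp, hel⟩ := hm₀ m hm (max m n) (le_max_left _ _)
    obtain ⟨Q, hQ⟩ := hP y
    obtain ⟨P, hP⟩ := hP x
    have := hc.finite m
    rw [hp x] at hper
    have h1 := lift_eq hel hne hP hQ hper fun i => by
      rw [hp x, hp y] at hxy
      exact congrFun hxy i
    have h2 := hc.itinerary_eq_of_le (le_max_right m n) (congrFun h1 0)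
    simpa [itinerary_zero] using h2

end Generating

/-! ### The towers of a Bratteli–Vershik system. -/

theorem tailAt_eq_append {T : Type} {y : ℤ → T} {d : ℤ} {l : List T}
    (h : ∀ (k : ℕ) (hk : k < l.length), y (d + k) = l[k]) :
    tailAt y d = l ++ₛ tailAt y (d + l.length) := by
  refine Stream'.ext fun n => ?_
  by_cases hn : n < l.length
  · rw [Stream'.get_append_left _ _ _ hn]
    exact h n hn
  · obtain ⟨k, rfl⟩ := Nat.exists_eq_add_of_le (not_lt.1 hn)
    rw [Stream'.get_append_right]
    change y (d + ((l.length + k : ℕ) : ℤ)) = y (d + l.length + k)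
    push_cast
    ring_nf

namespace OrderedBratteliDiagram
variable {B : OrderedBratteliDiagram}

theorem eq_of_isMin {n : ℕ} {e e' : B.E n} (he : IsMin e) (he' : IsMin e')
    (h : B.rng e = B.rng e') : e = e' := by
  rcases (B.comparable_iff n e e').2 h with h | h
  · exact he'.eq_of_le h
  · exact (he.eq_of_le h).symm

/-- The first `N` edges of a path. -/
def initial (B : OrderedBratteliDiagram) (N : ℕ) (x : B.Path) : ∀ k : Fin N, B.E k :=
  fun k => x.edge k

theorem initial_eq_iff {N : ℕ} {x y : B.Path} :
    B.initial N x = B.initial N y ↔ ∀ k < N, x.edge k = y.edge k :=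
  ⟨fun h k hk => congrFun h ⟨k, hk⟩, fun h => funext fun k => h k k.2⟩

/-- Each vertex has only one minimal incoming edge, so an initial segment of minimal edges can be
traced back from its end vertex. -/
theorem initial_eq_of_isMin {x y : B.Path} (n : ℕ) (hx : ∀ k < n, IsMin (x.edge k))
    (hy : ∀ k < n, IsMin (y.edge k)) (h : B.src (x.edge n) = B.src (y.edge n)) :
    ∀ k < n, x.edge k = y.edge k := by
  induction n with
  | zero => intro k hk; omega
  | succ n ih =>
    have h1 : x.edge n = y.edge n := by
      refine eq_of_isMin (hx n n.lt_succ_self) (hy n n.lt_succ_self) ?_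
      exact (x.2 n).trans (h.trans (y.2 n).symm)
    intro k hk
    rcases Nat.lt_succ_iff_lt_or_eq.1 hk with hk | rfl
    · exact ih (fun k hk => hx k (by omega)) (fun k hk => hy k (by omega)) (by rw [h1]) k hk
    · exact h1

/-- The first `N` edges are maximal. -/
def IsTop (N : ℕ) (x : B.Path) : Prop := ∀ k < N, IsMax (x.edge k)

/-- The first `N` edges are minimal. -/
def IsBase (N : ℕ) (x : B.Path) : Prop := ∀ k < N, IsMin (x.edge k)

theorem exists_first_not_isMax {N : ℕ} {x : B.Path} (h : ¬ IsTop N x) :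
    ∃ n < N, (∀ k < n, IsMax (x.edge k)) ∧ ¬ IsMax (x.edge n) := by
  classical
  have h' : ∃ n, n < N ∧ ¬ IsMax (x.edge n) := by
    simpa [IsTop] using h
  refine ⟨Nat.find h', (Nat.find_spec h').1, fun k hk => ?_, (Nat.find_spec h').2⟩
  have := Nat.find_min h' hk
  by_contra hcon
  exact this ⟨hk.trans (Nat.find_spec h').1, hcon⟩

theorem IsTop.congr {N : ℕ} {x y : B.Path} (h : B.initial N x = B.initial N y) (hx : IsTop N x) :
    IsTop N y := fun k hk => by
  rw [← initial_eq_iff.1 h k hk]; exact hx k hk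

namespace IsVershikMap
variable {φ : B.Path ≃ₜ B.Path} (hφ : B.IsVershikMap φ) {N : ℕ} {x y : B.Path}
include hφ

/-- When the first non-maximal edge is among the first `N`, the Vershik map finds it, and computes
all new edges below level `N`, from these `N` edges alone. -/
theorem initial_apply_eq (hx : ¬ IsTop N x) (h : B.initial N x = B.initial N y) :
    B.initial N (φ x) = B.initial N (φ y) := by
  obtain ⟨n, hn, h1, h2⟩ := exists_first_not_isMax hx
  rw [initial_eq_iff] at h ⊢
  obtain ⟨a1, a2, a3⟩ := hφ.2 x n h1 h2
  obtain ⟨b1, b2, b3⟩ := hφ.2 y n (fun k hk => by rw [← h k (by omega)]; exact h1 k hk)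
    (by rw [← h n hn]; exact h2)
  rw [← h n hn] at b2
  have h3 := a2.unique b2
  intro k hk
  rcases lt_trichotomy k n with hkn | rfl | hkn
  · exact initial_eq_of_isMin n a1 b1 (by rw [h3]) k hkn
  · exact h3
  · rw [a3 k hkn, b3 k hkn, h k hk]

/-- A path with some non-maximal edge has its first one at position `N` or later; for a wholly
maximal path the conclusion comes from the first clause of `IsVershikMap`. -/
theorem isBase_apply (hx : IsTop N x) : IsBase N (φ x) := by
  by_cases h : x ∈ B.maxPaths
  · exact fun k _ => hφ.1.mapsTo h k
  · obtain ⟨m, hm⟩ : ∃ m, ¬ IsMax (x.edge m) := by simpa [maxPaths] using h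
    obtain ⟨n, -, h1, h2⟩ := exists_first_not_isMax (N := m + 1) (x := x)
      fun h => hm (h m m.lt_succ_self)
    have hn : N ≤ n := by
      by_contra! hlt
      exact h2 (hx n hlt)
    exact fun k hk => (hφ.2 x n h1 h2).1 k (by omega)

theorem not_isBase_apply (hx : ¬ IsTop N x) : ¬ IsBase N (φ x) := by
  obtain ⟨n, hn, h1, h2⟩ := exists_first_not_isMax hx
  have h3 : x.edge n < (φ x).edge n := (hφ.2 x n h1 h2).2.1.1
  exact fun h => (h n hn).not_lt h3

/-- Climb to the top of the first `N` edges; one more step then moves edge `N` strictly up. As only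
finitely many edges lie above it, this ends. The clause on later edges is what lets edge `N` survive
the inner climb. -/
theorem exists_isTop (N : ℕ) : ∀ x : B.Path, ∃ j : ℕ, IsTop N ((φ ^ (j : ℤ)) x) ∧
    ∀ k ≥ N, ((φ ^ (j : ℤ)) x).edge k = x.edge k := by
  induction N with
  | zero => exact fun x => ⟨0, fun k hk => by omega, fun k _ => by simp⟩
  | succ N ih =>
    have hfin := B.finite_E N
    have key : ∀ (c : ℕ) (x : B.Path), {e | x.edge N < e}.ncard = c →
        ∃ j : ℕ, IsTop (N + 1) ((φ ^ (j : ℤ)) x) ∧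
          ∀ k ≥ N + 1, ((φ ^ (j : ℤ)) x).edge k = x.edge k := by
      intro c
      induction c using Nat.strong_induction_on with
      | _ c ihc =>
        intro x hx
        obtain ⟨j, hj, hj'⟩ := ih x
        by_cases hmax : IsMax (x.edge N)
        · refine ⟨j, fun k hk => ?_, fun k hk => hj' k (by omega)⟩
          rcases Nat.lt_succ_iff_lt_or_eq.1 hk with hk | rfl
          · exact hj k hk
          · rw [hj' k le_rfl]; exact hmax
        · obtain ⟨-, h1, h2⟩ := hφ.2 _ N hj (by rw [hj' N le_rfl]; exact hmax)
          have h3 := h1.1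
          rw [mem_ofPred_eq, hj' N le_rfl] at h3
          have hlt : {e | (φ ((φ ^ (j : ℤ)) x)).edge N < e}.ncard < c := by
            rw [← hx]
            refine Set.ncard_lt_ncard ⟨fun e he => h3.trans he, fun h => ?_⟩ (Set.toFinite _)
            exact lt_irrefl _ (h h3)
          obtain ⟨i, hi, hi'⟩ := ihc _ hlt _ rfl
          refine ⟨i + (j + 1), ?_, fun k hk => ?_⟩
          · rw [apply_zpow_apply, ← zpow_apply_add] at hi
            exact_mod_cast hi
          · have h4 := hi' k hk
            rw [h2 k (by omega), hj' k (by omega), apply_zpow_apply, ← zpow_apply_add] at h4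
            exact_mod_cast h4
    exact fun x => key _ x rfl

theorem initial_zpow_eq (h : B.initial N x = B.initial N y) (j : ℕ)
    (hj : ∀ i < j, ¬ IsTop N ((φ ^ (i : ℤ)) x)) :
    B.initial N ((φ ^ (j : ℤ)) x) = B.initial N ((φ ^ (j : ℤ)) y) := by
  induction j with
  | zero => simpa using h
  | succ j ih =>
    have := hφ.initial_apply_eq (hj j j.lt_succ_self) (ih fun i hi => hj i (by omega))
    rw [apply_zpow_apply, apply_zpow_apply] at this
    exact_mod_cast this

open Classical in
/-- The time after which a path reaches the top of its tower. -/
noncomputable def topTime (N : ℕ) (x : B.Path) : ℕ :=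
  Nat.find (p := fun j : ℕ => IsTop N ((φ ^ (j : ℤ)) x))
    ((exists_isTop hφ N x).imp fun _ h => h.1)

theorem isTop_topTime (N : ℕ) (x : B.Path) : IsTop N ((φ ^ (topTime hφ N x : ℤ)) x) := by
  classical
  exact Nat.find_spec (p := fun j : ℕ => IsTop N ((φ ^ (j : ℤ)) x)) _

theorem not_isTop_of_lt {i : ℕ} (hi : i < topTime hφ N x) :
    ¬ IsTop N ((φ ^ (i : ℤ)) x) := by
  classical
  exact Nat.find_min (p := fun j : ℕ => IsTop N ((φ ^ (j : ℤ)) x)) _ hi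

theorem initial_zpow_eq_of_le (h : B.initial N x = B.initial N y) {j : ℕ}
    (hj : j ≤ topTime hφ N x) :
    B.initial N ((φ ^ (j : ℤ)) x) = B.initial N ((φ ^ (j : ℤ)) y) :=
  hφ.initial_zpow_eq h j fun _ hi => hφ.not_isTop_of_lt (hi.trans_le hj)

theorem topTime_eq (h : B.initial N x = B.initial N y) :
    topTime hφ N x = topTime hφ N y := by
  have key : ∀ {x y : B.Path}, B.initial N x = B.initial N y →
      topTime hφ N y ≤ topTime hφ N x := by
    intro x y h
    by_contra! hlt
    exact hφ.not_isTop_of_lt hlt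
      ((hφ.isTop_topTime N x).congr (hφ.initial_zpow_eq_of_le h le_rfl))
  exact le_antisymm (key h.symm) (key h)

/-- The time to the top depends only on the first `N` edges, for which there are finitely many
choices. -/
theorem exists_topTime_le (N : ℕ) : ∃ L, ∀ x, topTime hφ N x ≤ L := by
  classical
  have hfin := B.finite_E
  have h : ∀ t : (∀ k : Fin N, B.E k), ∃ L, ∀ x, B.initial N x = t → topTime hφ N x ≤ L := by
    intro t
    by_cases h : ∃ x, B.initial N x = t
    · obtain ⟨x, rfl⟩ := h
      exact ⟨_, fun y hy => (hφ.topTime_eq hy).le⟩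
    · exact ⟨0, fun x hx => absurd ⟨x, hx⟩ h⟩
  choose L hL using h
  obtain ⟨M, hM⟩ := (Set.finite_range L).bddAbove
  exact ⟨M, fun x => (hL _ x rfl).trans (hM ⟨_, rfl⟩)⟩

/-- The towers of level `N` cut the itineraries into at most `Nat.card (B.V N)` words. -/
theorem codable (N : ℕ) : Codable φ B.initial N (Nat.card (B.V N)) := by
  classical
  have hfin := B.finite_V N
  let C := {v : B.V N // ∃ x : B.Path, IsBase N x ∧ B.src (x.edge N) = v}
  choose b hb hbv using fun v : C => v.2
  -- The word of a vertex lists the initial segments met from base to top, both included, hence the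
  -- `+ 1`.
  let β : C → List (∀ k : Fin N, B.E k) := fun v =>
    List.ofFn fun j : Fin (topTime hφ N (b v) + 1) => B.initial N ((φ ^ ((j : ℕ) : ℤ)) (b v))
  have hlen : ∀ v, (β v).length = topTime hφ N (b v) + 1 := fun v => by simp [β]
  have hinit : ∀ (z : B.Path) (v : C), IsBase N z → B.src (z.edge N) = v →
      B.initial N (b v) = B.initial N z := fun z v hz hv =>
    initial_eq_iff.2 (initial_eq_of_isMin N (hb v) hz ((hbv v).trans hv.symm))
  refine ⟨C, inferInstance, β, Nat.card_le_card_of_injective _ Subtype.val_injective,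
    fun v => List.length_pos_iff.1 (by rw [hlen]; omega), fun x => ?_⟩
  refine ⟨fun d v => IsBase N ((φ ^ d) x) ∧ B.src (((φ ^ d) x).edge N) = v, ?_, ?_, ?_, ?_, ?_⟩
  · intro i
    -- Starting at time `i - L - 1`, the top is reached within `L` steps and the next base one step
    -- later, so no later than `i`.
    obtain ⟨L, hL⟩ := hφ.exists_topTime_le N
    have h1 := hφ.isBase_apply (hφ.isTop_topTime N ((φ ^ (i - L - 1)) x))
    have h2 := hL ((φ ^ (i - L - 1)) x)
    rw [apply_zpow_apply, ← zpow_apply_add] at h1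
    exact ⟨_, ⟨_, _, h1, rfl⟩, ⟨h1, rfl⟩, by omega⟩
  · rintro d v ⟨hd, hv⟩
    have h1 := hφ.isBase_apply (hφ.isTop_topTime N ((φ ^ d) x))
    rw [← hφ.topTime_eq (hinit _ v hd hv), apply_zpow_apply, ← zpow_apply_add] at h1
    have e : d + ((β v).length : ℤ) = (topTime hφ N (b v) : ℤ) + 1 + d := by
      rw [hlen]; push_cast; ring
    rw [e]
    exact ⟨⟨_, _, h1, rfl⟩, h1, rfl⟩
  · rintro d v e w ⟨hd, hv⟩ ⟨he, -⟩ hde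
    by_contra! hlt
    rw [hlen, hφ.topTime_eq (hinit _ v hd hv)] at hlt
    -- The point just before a cut inside the tower is not at the top, so its image cannot be at a
    -- base.
    have h1 := hφ.not_isTop_of_lt (N := N) (x := (φ ^ d) x) (i := (e - 1 - d).toNat) (by omega)
    rw [← zpow_apply_add] at h1
    have h2 := hφ.not_isBase_apply h1
    rw [apply_zpow_apply] at h2
    refine h2 ?_
    convert he using 3
    omega
  · rintro d v w ⟨-, hv⟩ ⟨-, hw⟩
    exact Subtype.ext (hv.symm.trans hw)
  · rintro d v ⟨hd, hv⟩
    refine tailAt_eq_append fun k hk => ?_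
    have h1 : k ≤ topTime hφ N (b v) := by rw [hlen] at hk; omega
    have h2 := hφ.initial_zpow_eq_of_le (hinit _ v hd hv) h1
    rw [← zpow_apply_add, add_comm] at h2
    simp only [β, List.getElem_ofFn, itinerary]
    exact h2.symm

end IsVershikMap

theorem isClosed_edge_eq (n : ℕ) (t : B.E n) : IsClosed {x : B.Path | x.edge n = t} := by
  let _ : ∀ n, TopologicalSpace (B.E n) := fun n => ⊥
  have : DiscreteTopology (B.E n) := ⟨rfl⟩
  have h : Continuous fun x : B.Path => x.edge n :=
    (continuous_apply n).comp (continuous_induced_dom (f := fun x : B.Path => fun n => x.edge n))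
  exact (isClosed_discrete {t}).preimage h

theorem isCodeTower_initial (B : OrderedBratteliDiagram) : IsCodeTower B.initial where
  finite := fun N => by
    have := B.finite_E
    infer_instance
  isClosed := fun N t => by
    have : {x | B.initial N x = t} = ⋂ k : Fin N, {x : B.Path | x.edge k = t k} := by
      ext x
      simp [initial, funext_iff]
    rw [this]
    exact isClosed_iInter fun k => isClosed_edge_eq _ _
  proj := fun m n h => ⟨fun t k => t (Fin.castLE h k), fun x => rfl⟩
  sep := fun x y h => Subtype.ext (funext fun k =>
    initial_eq_iff.1 (h (k + 1)) k k.lt_succ_self)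

/-- A finite `liminf` bounds the vertex count at infinitely many levels only; this is enough because
word bounds descend. -/
theorem exists_frequently_card_le (B : OrderedBratteliDiagram)
    (h : B.toBratteliDiagram.rank < ⊤) : ∃ K : ℕ, ∃ᶠ n in atTop, Nat.card (B.V n) ≤ K := by
  obtain ⟨K, hK⟩ := ENat.ne_top_iff_exists.1 h.ne
  have h1 : B.toBratteliDiagram.rank < (K + 1 : ℕ) := by
    rw [← hK]
    exact_mod_cast K.lt_succ_self
  refine ⟨K, (frequently_lt_of_liminf_lt (by isBoundedDefault) h1).mono fun n hn => ?_⟩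
  have := B.finite_V n
  rw [ENat.card_eq_coe_natCard] at hn
  exact Nat.lt_succ_iff.1 (by exact_mod_cast hn)

end OrderedBratteliDiagram

/-! ### Transfer along the conjugacy and expansiveness. -/

theorem Homeomorph.zpow_semiconj {X Y : Type*} [TopologicalSpace X] [TopologicalSpace Y]
    {f : X ≃ₜ X} {g : Y ≃ₜ Y} {h : X → Y} (hfg : ∀ x, h (f x) = g (h x)) (i : ℤ) :
    ∀ x, h ((f ^ i) x) = (g ^ i) (h x) := by
  induction i with
  | zero => simp
  | succ i ih =>
    intro x
    rw [← apply_zpow_apply, ← apply_zpow_apply, hfg, ih]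
  | pred i ih =>
    intro x
    apply g.injective
    rw [← hfg, apply_zpow_apply, apply_zpow_apply, sub_add_cancel, ih]

theorem IsCodeTower.comp {X Y : Type*} [TopologicalSpace X] [TopologicalSpace Y]
    {T : ℕ → Type} {code : ∀ n, Y → T n} (hc : IsCodeTower code) (h : X ≃ₜ Y) :
    IsCodeTower fun n x => code n (h x) where
  finite := hc.finite
  isClosed := fun n t => (hc.isClosed n t).preimage h.continuous
  proj := fun m n hmn => (hc.proj m n hmn).imp fun _ hp x => hp (h x)
  sep := fun _ _ hxy => h.injective (hc.sep _ _ hxy)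

/-- A system with a generating code is expansive. -/
theorem IsCodeTower.isExpansive {X : Type*} [MetricSpace X] [CompactSpace X] {f : X ≃ₜ X}
    {T : ℕ → Type} {code : ∀ n, X → T n} (hc : IsCodeTower code) {m : ℕ}
    (hm : ∀ x y : X, itinerary f code m x = itinerary f code m y → x = y) : IsExpansive f := by
  have hfin := hc.finite m
  have hopen : ∀ t, IsOpen {x | code m x = t} := by
    intro t
    have : {x | code m x = t}ᶜ = ⋃ s : {s // s ≠ t}, {x | code m x = s} := by
      ext x
      simp
    rw [← isClosed_compl_iff, this]
    exact isClosed_iUnion_of_finite fun s => hc.isClosed m s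
  -- With a Lebesgue number of the clopen partition, points at distance less than `δ` share their
  -- code, so orbits that stay within `δ / 2` of each other have equal itineraries.
  obtain ⟨δ, hδ, h⟩ := lebesgue_number_lemma_of_metric isCompact_univ hopen
    fun x _ => mem_iUnion.2 ⟨code m x, rfl⟩
  refine ⟨δ / 2, by positivity, fun x y hxy => ?_⟩
  by_contra! hcon
  refine hxy (hm x y (funext fun i => ?_))
  obtain ⟨t, ht⟩ := h ((f ^ i) x) (mem_univ _)
  have h1 : code m ((f ^ i) x) = t := ht (Metric.mem_ball_self hδ)
  have h2 : code m ((f ^ i) y) = t := ht (by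
    rw [Metric.mem_ball, dist_comm]
    linarith [hcon i])
  exact h1.trans h2.symm

theorem theorem4p4 {X : Type*} [MetricSpace X] [CompactSpace X]
    (hX : TopologicalSpace.IsTopologicalBasis {U : Set X | IsClopen U})
    (f : X ≃ₜ X) (hrank : topologicalRank f < ⊤)
    (hodo : ∀ M : Set X, IsMinimalSet f M → ¬ IsOdometerOn f M) :
    IsExpansive f := by
  obtain ⟨_, ⟨B, φ, ⟨hφ, h, hh⟩, rfl⟩, hB⟩ := sInf_lt_iff.1 hrank
  obtain ⟨K, hK⟩ := B.exists_frequently_card_le hB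
  -- The code is pulled back to `X`, so the hypothesis on minimal sets of `f` applies without being
  -- transported.
  have hc := B.isCodeTower_initial.comp h
  have hitin : ∀ n x, itinerary f (fun n x => B.initial n (h x)) n x =
      itinerary φ B.initial n (h x) := fun n x =>
    funext fun i => congrArg (B.initial n) (Homeomorph.zpow_semiconj hh i x)
  have hcod : ∃ᶠ n in atTop, Codable f (fun n x => B.initial n (h x)) n K := by
    refine hK.mono fun n hn => ?_
    obtain ⟨C, hC, β, h1, h2, h3⟩ := hφ.codable n
    refine ⟨C, hC, β, h1.trans hn, h2, fun x => ?_⟩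
    rw [hitin]
    exact h3 (h x)
  obtain ⟨m, hm⟩ := hc.exists_generating hcod hodo
  exact hc.isExpansive hm
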